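/- Let $S^2$ be the unit sphere in Euclidean 3-space with spherical distance $|xy|=\arccos\langle x,y\rangle$. The disk of radius $\rho$ with center $c$ is $\{p\in S^2: |cp|\le\rho\}$; a hemisphere is a disk of radius $\pi/2$. A convex body is a closed set $C\subset S^2$ with non-empty interior that contains no pair of antipodes and contains, with any two of its points, the shorter great-circle arc joining them. A hemisphere $K$ supports $C$ if $C\subset K$ and $\mathrm{bd}(C)\cap\mathrm{bd}(K)\neq\emptyset$. For two different, non-opposite hemispheres $G,H$ the thickness of the lune $G\cap H$ is the spherical distance between the centers of the two semicircles bounding it. For a hemisphere $K$ supporting $C$, $\mathrm{width}_K(C)$ is the minimum thickness of the lunes $K\cap K'$ over the hemispheres $K'$ supporting $C$ (different from $K$ and not opposite to it), and the thickness $\Delta(C)$ is the minimum of $\mathrm{width}_K(C)$ over all hemispheres $K$ supporting $C$. A convex body $R$ is reduced if $\Delta(Z)<\Delta(R)$ for every convex body $Z\subset R$ with $Z\ne R$. **Theorem.** Every reduced convex body $R\subset S^2$ with $\Delta(R)\le\frac{\pi}{2}$ is contained in a disk of radius $\arctan\left(\sqrt2\,\tan\frac{\Delta(R)}{2}\right)$.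 This estimate cannot be improved: for every $\delta\in(0,\frac{\pi}{2}]$, each quarter of a disk of radius $\delta$ (one of the four parts into which the disk is cut by two perpendicular great circles through its center) is a reduced convex body of thickness $\delta$, and it is contained in no disk of radius smaller than $\arctan\left(\sqrt2\,\tan\frac{\delta}{2}\right)$. -/

import Mathlib

namespace Spherical

open Real Set

/-- Euclidean 3-space. -/
abbrev E3 : Type := EuclideanSpace ℝ (Fin 3)

/-- The unit sphere `S²`, with the topology induced from Euclidean 3-space. -/
abbrev S2 : Type := Metric.sphere (0 : E3) 1

/-- Spherical distance: the length of the shorter great-circle arc, `π` for antipodes. -/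
noncomputable def sdist (x y : S2) : ℝ :=
  InnerProductGeometry.angle (x : E3) (y : E3)

/-- The spherical disk of radius `ρ` with center `c`. -/
def disk (c : S2) (ρ : ℝ) : Set S2 := {p | sdist c p ≤ ρ}

/-- The hemisphere `H(m)` with center `m`. -/
noncomputable def hemisphere (m : S2) : Set S2 := disk m (π / 2)

/-- The arc joining `a` and `b`: the points of the sphere in the cone spanned by `a` and `b`.
For `a`, `b` not antipodal it is the shorter part of the great circle through `a` and `b`
(and it is `{a}` when `a = b`). -/
def arc (a b : S2) : Set S2 :=
  {p | ∃ s t : ℝ, 0 ≤ s ∧ 0 ≤ t ∧ (p : E3) = s • (a : E3) + t • (b : E3)}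

/-- Spherical convexity: no pair of antipodes, and closed under taking arcs. -/
def IsConvex (C : Set S2) : Prop :=
  (∀ a ∈ C, -a ∉ C) ∧ ∀ a ∈ C, ∀ b ∈ C, arc a b ⊆ C

/-- A convex body: a closed convex set with non-empty interior. -/
def IsConvexBody (C : Set S2) : Prop :=
  IsClosed C ∧ IsConvex C ∧ (interior C).Nonempty

/-- The hemisphere with center `m` supports `C`: it contains `C` and the boundaries meet. -/
def Supports (m : S2) (C : Set S2) : Prop :=
  C ⊆ hemisphere m ∧ (frontier C ∩ frontier (hemisphere m)).Nonempty

/-- The center of the semicircle `H(g)/H(h)` (the part of the bounding great circle of `H(g)`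
that lies in `H(h)`): the normalized orthogonal projection of `h` to the plane `g^⊥`,
see `semicircleCenter_spec`. -/
noncomputable def semicircleCenter (g h : S2) : E3 :=
  ‖(h : E3) - inner ℝ (g : E3) (h : E3) • (g : E3)‖⁻¹ •
    ((h : E3) - inner ℝ (g : E3) (h : E3) • (g : E3))

/-- The thickness of the lune `H(g) ∩ H(h)`, for `h` different from `g` and `-g`: the spherical
distance of the centers of the two semicircles that bound it. -/
noncomputable def luneThickness (g h : S2) : ℝ :=
  InnerProductGeometry.angle (semicircleCenter g h) (semicircleCenter h g)

/-- The width of `C` determined by the hemisphere `H(k)`: the least thickness of a lune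
`H(k) ∩ H(m)` with `H(m)` supporting `C`. -/
noncomputable def width (k : S2) (C : Set S2) : ℝ :=
  sInf {w | ∃ m : S2, Supports m C ∧ m ≠ k ∧ m ≠ -k ∧ w = luneThickness k m}

/-- The thickness `Δ(C)`: the least width of `C` over all supporting hemispheres. -/
noncomputable def thickness (C : Set S2) : ℝ :=
  sInf {w | ∃ k : S2, Supports k C ∧ w = width k C}

/-- A reduced body: a convex body all of whose proper convex sub-bodies have smaller thickness. -/
def IsReduced (R : Set S2) : Prop :=
  IsConvexBody R ∧ ∀ K : Set S2, IsConvexBody K → K ⊆ R → K ≠ R → thickness K < thickness R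

/-- The part of the disk of radius `δ` with center `o` cut off by the hemispheres `H(u)` and
`H(v)`. When `o`, `u`, `v` are pairwise orthogonal, the bounding great circles of these
hemispheres pass through `o` and are perpendicular, and this is a quarter of the disk. -/
def quarterDisk (o u v : S2) (δ : ℝ) : Set S2 :=
  disk o δ ∩ hemisphere u ∩ hemisphere v

theorem mem_hemisphere (m p : S2) : p ∈ hemisphere m ↔ 0 ≤ inner ℝ (m : E3) (p : E3) := by
  have hm : ‖(m : E3)‖ = 1 := by simp
  simp [hemisphere, disk, sdist, InnerProductGeometry.angle, Real.arccos_le_pi_div_two, hm]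

/-- `semicircleCenter g h` is a point of the sphere on the bounding great circle of `H(g)`, and
the points of this great circle in `H(h)` are those at distance at most `π / 2` from it. -/
theorem semicircleCenter_spec (g h : S2) (h₁ : h ≠ g) (h₂ : h ≠ -g) :
    ‖semicircleCenter g h‖ = 1 ∧ inner ℝ (g : E3) (semicircleCenter g h) = 0 ∧
      ∀ p : S2, inner ℝ (g : E3) (p : E3) = 0 →
        (p ∈ hemisphere h ↔
          InnerProductGeometry.angle (semicircleCenter g h) (p : E3) ≤ π / 2) := by
  have hg : ‖(g : E3)‖ = 1 := by simp
  have hh : ‖(h : E3)‖ = 1 := by simp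
  have hne : (h : E3) - inner ℝ (g : E3) (h : E3) • (g : E3) ≠ 0 := by
    intro h0
    have e : (h : E3) = inner ℝ (g : E3) (h : E3) • (g : E3) := sub_eq_zero.mp h0
    have ha : |inner ℝ (g : E3) (h : E3)| = 1 := by
      have := congrArg norm e
      rw [norm_smul, hh, hg] at this
      simpa using this.symm
    rcases eq_or_eq_neg_of_abs_eq ha with h' | h'
    · exact h₁ (Subtype.ext (by rw [e, h']; simp))
    · exact h₂ (Subtype.ext (by rw [e, h']; simp))
  have hpos : 0 < ‖(h : E3) - inner ℝ (g : E3) (h : E3) • (g : E3)‖ := norm_pos_iff.mpr hne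
  refine ⟨?_, ?_, ?_⟩
  · rw [semicircleCenter, norm_smul, norm_inv, norm_norm, inv_mul_cancel₀ hpos.ne']
  · rw [semicircleCenter, inner_smul_right, inner_sub_right, inner_smul_right,
      real_inner_self_eq_norm_sq, hg]
    simp
  · intro p hp
    rw [mem_hemisphere, semicircleCenter,
      InnerProductGeometry.angle_smul_left_of_pos _ _ (inv_pos.mpr hpos),
      InnerProductGeometry.angle, Real.arccos_le_pi_div_two, inner_sub_left, inner_smul_left, hp]
    have hp1 : ‖(p : E3)‖ = 1 := by simp
    rw [hp1, mul_one, mul_zero, sub_zero, div_nonneg_iff]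
    constructor
    · intro h; exact Or.inl ⟨h, hpos.le⟩
    · rintro (h | h)
      · exact h.1
      · exact absurd h.2 (not_le.mpr hpos)

end Spherical

/-!
The polar of a convex body `C` consists of the centers of the hemispheres containing `C`. Two of
these centers at distance `d` give a lune of thickness `π - d` around `C`, so `thickness C` belongs
to a diametral pair of the polar; a first variation argument shows that the centers of the two
semicircles bounding the corresponding lune lie in `C`.

Let `R` be reduced of thickness `δ ≤ π / 2`. Cutting smaller and smaller caps off `R` at an exposed
point shows that this point is the center of a semicircle bounding a lune of thickness `δ` around
`R`. The point `x` of least norm in the convex hull of `R` is the direction of the center of the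
smallest disk around `R`, and by Carathéodory's theorem it is a convex combination of three exposed
points of `R`. Each of the three lunes attached to these points contains the semicircle centers of
the other two, which forces the sides `s` of the triangle to satisfy `cos s ≥ cos δ ^ 2` and its
heights to be at most `δ`. Such a triangle has circumradius at most `arctan (√2 * tan (δ / 2))`, in
the form of a lower bound for `‖x‖`, attained by the right triangle whose legs have length `δ`.

The corners of a quarter of a disk of radius `δ` form this extremal triangle. A body contained in
the quarter and at least as thick contains the center and each point of the bounding circular arc,
for otherwise some lune of thickness `δ` around the quarter could be narrowed around the body.
-/

namespace Spherical

open Real Set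
open scoped InnerProductSpace

section ConvexHull

variable {E : Type*}

lemma exists_fin_sum_smul_eq [AddCommGroup E] [Module ℝ E] {ι : Type*} [Fintype ι] {n : ℕ}
    (hn : Fintype.card ι ≤ n) {w : ι → ℝ} (hw : w ∈ stdSimplex ℝ ι) (z : ι → E) :
    ∃ f : Fin n → ι, ∃ w' ∈ stdSimplex ℝ (Fin n), ∑ j, w' j • z (f j) = ∑ i, w i • z i := by
  obtain ⟨g⟩ := Function.Embedding.nonempty_of_card_le (hn.trans_eq (Fintype.card_fin n).symm)
  have : Nonempty ι := by
    by_contra h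
    rw [not_nonempty_iff] at h
    simpa using hw.2
  have hout : ∀ j ∉ range g, Function.extend g w 0 j = 0 := fun j hj =>
    Function.extend_apply' _ _ _ hj
  have hin : ∀ i, w i = Function.extend g w 0 (g i) := fun i =>
    (g.injective.extend_apply w 0 i).symm
  refine ⟨Function.invFun g, Function.extend g w 0, ⟨fun j => ?_, ?_⟩, ?_⟩
  · by_cases hj : j ∈ range g
    · obtain ⟨i, rfl⟩ := hj
      exact hin i ▸ hw.1 i
    · rw [hout j hj]
  · rw [← hw.2]
    exact (Fintype.sum_of_injective g g.injective _ _ hout hin).symm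
  · refine (Fintype.sum_of_injective g g.injective _ _ (fun j hj => ?_) fun i => ?_).symm
    · rw [hout j hj, zero_smul]
    · rw [Function.leftInverse_invFun g.injective i, ← hin i]

lemma isCompact_convexHull [NormedAddCommGroup E] [NormedSpace ℝ E] [FiniteDimensional ℝ E]
    {s : Set E} (hs : IsCompact s) : IsCompact (convexHull ℝ s) := by
  let n := Module.finrank ℝ E + 1
  suffices convexHull ℝ s = (fun q : (Fin n → ℝ) × (Fin n → E) => ∑ i, q.1 i • q.2 i) ''
      (stdSimplex ℝ (Fin n) ×ˢ univ.pi fun _ => s) by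
    rw [this]
    exact ((isCompact_stdSimplex ℝ _).prod (isCompact_univ_pi fun _ => hs)).image (by fun_prop)
  refine Subset.antisymm (fun x hx => ?_) ?_
  · obtain ⟨ι, _, z, w, hz, hind, hw, hsum, rfl⟩ := eq_pos_convex_span_of_mem_convexHull hx
    obtain ⟨f, w', hw', heq⟩ := exists_fin_sum_smul_eq (n := n)
      (hind.card_le_finrank_succ.trans (Nat.succ_le_succ (Submodule.finrank_le _)))
      ⟨fun i => (hw i).le, hsum⟩ z
    exact ⟨(w', z ∘ f), ⟨hw', fun j _ => hz ⟨f j, rfl⟩⟩, heq⟩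
  · rintro _ ⟨⟨w, z⟩, ⟨⟨hw, hsum⟩, hz⟩, rfl⟩
    exact (convex_convexHull ℝ s).sum_mem (fun i _ => hw i) hsum
      fun i _ => subset_convexHull ℝ s (hz i trivial)

lemma mem_convexHull_face [AddCommGroup E] [Module ℝ E] {s : Set E} {f : E →ₗ[ℝ] ℝ} {c : ℝ}
    (hf : ∀ y ∈ s, c ≤ f y) {x : E} (hx : x ∈ convexHull ℝ s) (hxc : f x = c) :
    x ∈ convexHull ℝ {y ∈ s | f y = c} := by
  set F := convexHull ℝ {y ∈ s | f y = c}
  have hconv : Convex ℝ {y | c ≤ f y ∧ (f y = c → y ∈ F)} := by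
    rw [convex_iff_forall_pos]
    rintro y ⟨hy, hyF⟩ z ⟨hz, hzF⟩ a b ha hb hab
    have hle : c = a * c + b * c := by rw [← add_mul, hab, one_mul]
    have hay := mul_le_mul_of_nonneg_left hy ha.le
    have hbz := mul_le_mul_of_nonneg_left hz hb.le
    simp only [mem_ofPred_eq, map_add, map_smul, smul_eq_mul]
    refine ⟨by linarith, fun h => ?_⟩
    have hyc : f y = c := mul_left_cancel₀ ha.ne' (by linarith)
    have hzc : f z = c := mul_left_cancel₀ hb.ne' (by linarith)
    exact convex_convexHull ℝ _ (hyF hyc) (hzF hzc) ha.le hb.le hab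
  have hsub : s ⊆ {y | c ≤ f y ∧ (f y = c → y ∈ F)} := fun y hy =>
    ⟨hf y hy, fun h => subset_convexHull ℝ _ ⟨hy, h⟩⟩
  exact (convexHull_min hsub hconv hx).2 hxc

-- Carathéodory's theorem saves one point in a hyperplane that avoids the origin, because affinely
-- independent points of it are linearly independent.
lemma exists_fin_sum_smul_eq_of_mem_convexHull [AddCommGroup E] [Module ℝ E]
    [FiniteDimensional ℝ E] {n : ℕ} (hn : Module.finrank ℝ E ≤ n) {s : Set E} {f : E →ₗ[ℝ] ℝ}
    {c : ℝ} (hc : c ≠ 0) (hf : ∀ y ∈ s, f y = c) {x : E} (hx : x ∈ convexHull ℝ s) :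
    ∃ z : Fin n → E, (∀ i, z i ∈ s) ∧ ∃ w ∈ stdSimplex ℝ (Fin n), ∑ i, w i • z i = x := by
  obtain ⟨ι, _, z, w, hz, hind, hw, hsum, rfl⟩ := eq_pos_convex_span_of_mem_convexHull hx
  have hlin : LinearIndependent ℝ z := by
    rw [Fintype.linearIndependent_iff]
    intro g hg i
    have hg0 : (∑ i, g i) * c = 0 := by
      have := congrArg f hg
      simpa only [map_sum, map_smul, smul_eq_mul, hf _ (hz ⟨_, rfl⟩), ← Finset.sum_mul,
        map_zero] using this
    exact affineIndependent_iff.1 hind Finset.univ g ((mul_eq_zero.1 hg0).resolve_right hc) hg i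
      (Finset.mem_univ i)
  obtain ⟨g, w', hw', heq⟩ :=
    exists_fin_sum_smul_eq (hlin.fintype_card_le_finrank.trans hn) ⟨fun i => (hw i).le, hsum⟩ z
  exact ⟨z ∘ g, fun j => hz ⟨g j, rfl⟩, w', hw', heq⟩

lemma exists_forall_norm_sq_le_inner [NormedAddCommGroup E] [InnerProductSpace ℝ E] {K : Set E}
    (hne : K.Nonempty) (hcomp : IsComplete K) (hconv : Convex ℝ K) :
    ∃ x ∈ K, ∀ y ∈ K, ‖x‖ ^ 2 ≤ ⟪x, y⟫_ℝ := by
  obtain ⟨x, hxK, hx⟩ := exists_norm_eq_iInf_of_complete_convex hne hcomp hconv 0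
  rw [norm_eq_iInf_iff_real_inner_le_zero hconv hxK] at hx
  refine ⟨x, hxK, fun y hy => ?_⟩
  have := hx y hy
  rw [zero_sub, inner_neg_left, inner_sub_right, real_inner_self_eq_norm_sq] at this
  linarith

end ConvexHull

/-! ### Points of the sphere and lunes -/

/-- The point of the sphere in the direction of a nonzero vector. -/
noncomputable def unitVec (x : E3) (hx : x ≠ 0) : S2 :=
  ⟨‖x‖⁻¹ • x, by simp [norm_smul, hx]⟩

lemma inner_unitVec {x : E3} (hx : x ≠ 0) (y : E3) :
    ⟪(unitVec x hx : E3), y⟫_ℝ = ‖x‖⁻¹ * ⟪x, y⟫_ℝ :=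
  real_inner_smul_left _ _ _

lemma inner_unitVec_right {x : E3} (hx : x ≠ 0) (y : E3) :
    ⟪y, (unitVec x hx : E3)⟫_ℝ = ‖x‖⁻¹ * ⟪y, x⟫_ℝ :=
  real_inner_smul_right _ _ _

lemma inner_coe_self (a : S2) : ⟪(a : E3), a⟫_ℝ = 1 := by simp

lemma inner_coe_le_one (a b : S2) : ⟪(a : E3), b⟫_ℝ ≤ 1 := by
  simpa using real_inner_le_norm (a : E3) b

lemma neg_one_le_inner_coe (a b : S2) : -1 ≤ ⟪(a : E3), b⟫_ℝ := by
  simpa using neg_le_of_abs_le (abs_real_inner_le_norm (a : E3) b)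

lemma inner_coe_lt_one {a b : S2} (h : a ≠ b) : ⟪(a : E3), b⟫_ℝ < 1 :=
  (inner_lt_one_iff_real_of_norm_eq_one (norm_eq_of_mem_sphere a) (norm_eq_of_mem_sphere b)).2
    (Subtype.coe_injective.ne h)

lemma neg_one_lt_inner_coe {a b : S2} (h : a ≠ -b) : -1 < ⟪(a : E3), b⟫_ℝ := by
  have := inner_coe_lt_one h
  rw [coe_neg_sphere, inner_neg_right] at this
  linarith

lemma inner_sq_lt_one {a b : S2} (h₁ : b ≠ a) (h₂ : b ≠ -a) : ⟪(a : E3), b⟫_ℝ ^ 2 < 1 := by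
  rw [real_inner_comm, sq_lt_one_iff_abs_lt_one, abs_lt]
  exact ⟨neg_one_lt_inner_coe h₂, inner_coe_lt_one h₁⟩

lemma sdist_eq_arccos (a b : S2) : sdist a b = arccos ⟪(a : E3), b⟫_ℝ := by
  simp [sdist, InnerProductGeometry.angle]

lemma cos_sdist (a b : S2) : cos (sdist a b) = ⟪(a : E3), b⟫_ℝ := by
  rw [sdist_eq_arccos, cos_arccos (neg_one_le_inner_coe a b) (inner_coe_le_one a b)]

lemma exists_ne_ne_neg (k : S2) : ∃ m : S2, m ≠ k ∧ m ≠ -k := by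
  by_contra! h
  let a : S2 := ⟨EuclideanSpace.single 0 1, by simp⟩
  let b : S2 := ⟨EuclideanSpace.single 1 1, by simp⟩
  have hab : ⟪(a : E3), b⟫_ℝ = 0 := by simp [a, b, EuclideanSpace.inner_single_left]
  have ha : a = k ∨ a = -k := or_iff_not_imp_left.2 (h a)
  have hb : b = k ∨ b = -k := or_iff_not_imp_left.2 (h b)
  rcases ha with ha | ha <;> rcases hb with hb | hb <;> simp [ha, hb] at hab

lemma exists_mem_open_smul_add {U : Set S2} (hU : IsOpen U) {p : S2} (hp : p ∈ U) (y : E3) :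
    ∃ q ∈ U, ∃ s > (0 : ℝ), ∃ t > (0 : ℝ), (q : E3) = s • ((p : E3) + t • y) := by
  obtain ⟨V, hV, rfl⟩ := isOpen_induced_iff.1 hU
  have hcont : Continuous fun t : ℝ => (p : E3) + t • y := by fun_prop
  have hne : ∀ᶠ t in nhds (0 : ℝ), (p : E3) + t • y ≠ 0 :=
    hcont.continuousAt.eventually_ne (by simpa using ne_zero_of_mem_unit_sphere p)
  have hmem : ∀ᶠ t in nhds (0 : ℝ), ‖(p : E3) + t • y‖⁻¹ • ((p : E3) + t • y) ∈ V := by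
    refine ((hcont.norm.continuousAt.inv₀ (by simp)).smul hcont.continuousAt).eventually_mem
      (hV.mem_nhds ?_)
    simpa using hp
  obtain ⟨t, ⟨hne, hmem⟩, ht⟩ := (((hne.and hmem).filter_mono nhdsWithin_le_nhds).and
    (self_mem_nhdsWithin (s := Ioi 0))).exists
  exact ⟨unitVec _ hne, hmem, _, inv_pos.2 (norm_pos_iff.2 hne), t, ht, rfl⟩

lemma exists_mem_open_inner_ne_zero {U : Set S2} (hU : IsOpen U) (hne : U.Nonempty) {y : E3}
    (hy : y ≠ 0) : ∃ p ∈ U, ⟪y, (p : E3)⟫_ℝ ≠ 0 := by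
  obtain ⟨p, hp⟩ := hne
  by_cases h : ⟪y, (p : E3)⟫_ℝ = 0
  · obtain ⟨q, hq, s, hs, t, ht, hqe⟩ := exists_mem_open_smul_add hU hp y
    refine ⟨q, hq, ?_⟩
    rw [hqe, real_inner_smul_right, inner_add_right, h, real_inner_smul_right, zero_add]
    exact mul_ne_zero hs.ne' (mul_ne_zero ht.ne' (inner_self_ne_zero.2 hy))
  · exact ⟨p, hp, h⟩

lemma norm_sub_inner_smul (g h : S2) :
    ‖(h : E3) - ⟪(g : E3), h⟫_ℝ • (g : E3)‖ = √(1 - ⟪(g : E3), h⟫_ℝ ^ 2) := by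
  rw [← sqrt_sq (norm_nonneg _), ← real_inner_self_eq_norm_sq]
  simp only [inner_sub_left, inner_sub_right, real_inner_smul_left, real_inner_smul_right,
    inner_coe_self, real_inner_comm (g : E3) (h : E3)]
  ring_nf

lemma sub_inner_smul_eq_semicircleCenter (g h : S2) :
    (h : E3) - ⟪(g : E3), h⟫_ℝ • (g : E3) =
      √(1 - ⟪(g : E3), h⟫_ℝ ^ 2) • semicircleCenter g h := by
  rw [semicircleCenter, ← norm_sub_inner_smul, smul_smul]
  rcases eq_or_ne ((h : E3) - ⟪(g : E3), h⟫_ℝ • (g : E3)) 0 with h0 | h0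
  · rw [h0, smul_zero]
  · rw [mul_inv_cancel₀ (norm_ne_zero_iff.2 h0), one_smul]

lemma luneThickness_eq {g h : S2} (h₁ : h ≠ g) (h₂ : h ≠ -g) :
    luneThickness g h = arccos (-⟪(g : E3), h⟫_ℝ) := by
  have hpos : 0 < 1 - ⟪(g : E3), h⟫_ℝ ^ 2 := sub_pos.2 (inner_sq_lt_one h₁ h₂)
  have hcomm : ⟪(h : E3), g⟫_ℝ = ⟪(g : E3), h⟫_ℝ := real_inner_comm _ _
  have hprod : (1 - ⟪(g : E3), h⟫_ℝ ^ 2) * ⟪semicircleCenter g h, semicircleCenter h g⟫_ℝ =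
      (1 - ⟪(g : E3), h⟫_ℝ ^ 2) * -⟪(g : E3), h⟫_ℝ := by
    calc _ = ⟪(h : E3) - ⟪(g : E3), h⟫_ℝ • (g : E3), (g : E3) - ⟪(h : E3), g⟫_ℝ • (h : E3)⟫_ℝ := by
          rw [sub_inner_smul_eq_semicircleCenter g h, sub_inner_smul_eq_semicircleCenter h g,
            hcomm, real_inner_smul_left, real_inner_smul_right, ← mul_assoc, mul_self_sqrt hpos.le]
      _ = _ := by
          simp only [inner_sub_left, inner_sub_right, real_inner_smul_left, real_inner_smul_right,
            inner_coe_self, hcomm]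
          ring
  rw [luneThickness, InnerProductGeometry.angle, (semicircleCenter_spec g h h₁ h₂).1,
    (semicircleCenter_spec h g h₁.symm fun h' => h₂ (by rw [h', neg_neg])).1, mul_one, div_one,
    mul_left_cancel₀ hpos.ne' hprod]

/-! ### Polars of convex bodies -/

/-- The polar of `C`: the centers of the hemispheres that contain `C`. -/
def polar (C : Set S2) : Set S2 := {m | ∀ p ∈ C, 0 ≤ ⟪(m : E3), p⟫_ℝ}

lemma subset_hemisphere_iff {C : Set S2} {m : S2} : C ⊆ hemisphere m ↔ m ∈ polar C :=
  forall₂_congr fun p _ => mem_hemisphere m p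

lemma isClosed_polar (C : Set S2) : IsClosed (polar C) := by
  have : polar C = ⋂ p ∈ C, {m : S2 | 0 ≤ ⟪(m : E3), p⟫_ℝ} := by ext; simp [polar]
  rw [this]
  exact isClosed_biInter fun p _ => isClosed_le continuous_const (by fun_prop)

lemma mem_interior_polar {C : Set S2} (hC : IsClosed C) {k : S2}
    (hk : ∀ p ∈ C, 0 < ⟪(k : E3), p⟫_ℝ) : k ∈ interior (polar C) := by
  rw [mem_interior_iff_mem_nhds]
  have hev : ∀ᶠ a : S2 in nhds k, ∀ p ∈ C, 0 < ⟪(a : E3), p⟫_ℝ := by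
    refine hC.isCompact.eventually_forall_of_forall_eventually fun p hp => ?_
    have hcont : Continuous fun q : S2 × S2 => ⟪(q.1 : E3), (q.2 : E3)⟫_ℝ := by fun_prop
    exact hcont.continuousAt.eventually_const_lt (hk p hp)
  exact hev.mono fun a ha p hp => (ha p hp).le

lemma exists_mem_polar_inner_lt {C : Set S2} (hC : IsClosed C) {k m : S2}
    (hk : ∀ p ∈ C, 0 < ⟪(k : E3), p⟫_ℝ) (h₁ : m ≠ k) (h₂ : m ≠ -k) :
    ∃ a ∈ polar C, ⟪(a : E3), m⟫_ℝ < ⟪(k : E3), m⟫_ℝ := by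
  obtain ⟨a, ha, s, hs, t, ht, hae⟩ :=
    exists_mem_open_smul_add isOpen_interior (mem_interior_polar hC hk) (-(m : E3))
  refine ⟨a, interior_subset ha, ?_⟩
  set n := ‖(k : E3) + t • -(m : E3)‖
  have hsn : s * n = 1 := by
    have := norm_eq_of_mem_sphere a
    rwa [hae, norm_smul, norm_of_nonneg hs.le] at this
  have hn : |1 - n| ≤ t := by
    have := abs_norm_sub_norm_le (k : E3) ((k : E3) + t • -(m : E3))
    simpa [n, norm_smul, abs_of_pos ht] using this
  have hw : |⟪(k : E3), m⟫_ℝ| < 1 := (sq_lt_one_iff_abs_lt_one _).1 (inner_sq_lt_one h₁ h₂)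
  have hlt : ⟪(k : E3), m⟫_ℝ * (1 - n) < t :=
    calc _ ≤ |⟪(k : E3), m⟫_ℝ| * |1 - n| := (le_abs_self _).trans_eq (abs_mul _ _)
      _ ≤ |⟪(k : E3), m⟫_ℝ| * t := by gcongr
      _ < t := mul_lt_of_lt_one_left ht hw
  calc ⟪(a : E3), m⟫_ℝ = s * (⟪(k : E3), m⟫_ℝ - t) := by
        rw [hae, real_inner_smul_left, inner_add_left, real_inner_smul_left, inner_neg_left,
          inner_coe_self]
        ring
    _ < s * (⟪(k : E3), m⟫_ℝ * n) := mul_lt_mul_of_pos_left (by linarith) hs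
    _ = ⟪(k : E3), m⟫_ℝ := by rw [mul_left_comm, hsn, mul_one]

lemma IsConvexBody.ne_neg_of_mem_polar {C : Set S2} (hC : IsConvexBody C) {k m : S2}
    (hk : k ∈ polar C) (hm : m ∈ polar C) : k ≠ -m := by
  rintro rfl
  obtain ⟨p, hp, hne⟩ := exists_mem_open_inner_ne_zero isOpen_interior hC.2.2
    (ne_zero_of_mem_unit_sphere m)
  have hneg := hk p (interior_subset hp)
  rw [coe_neg_sphere, inner_neg_left] at hneg
  exact hne (le_antisymm (by linarith) (hm p (interior_subset hp)))

lemma inner_pos_of_mem_interior {C : Set S2} {m p : S2} (hm : m ∈ polar C) (hp : p ∈ interior C) :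
    0 < ⟪(m : E3), p⟫_ℝ := by
  obtain ⟨q, hq, s, hs, t, ht, hqe⟩ := exists_mem_open_smul_add isOpen_interior hp (-(m : E3))
  have hmq := hm q (interior_subset hq)
  rw [hqe, real_inner_smul_right, inner_add_right, real_inner_smul_right, inner_neg_right,
    inner_coe_self] at hmq
  linarith [nonneg_of_mul_nonneg_right hmq hs]

lemma supports_iff {C : Set S2} (hC : IsClosed C) {m : S2} :
    Supports m C ↔ m ∈ polar C ∧ ∃ p ∈ C, ⟪(m : E3), p⟫_ℝ = 0 := by
  rw [Supports, subset_hemisphere_iff]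
  refine and_congr_right fun hm => ⟨?_, ?_⟩
  · rintro ⟨p, hpC, hpm⟩
    refine ⟨p, hC.frontier_subset hpC, ((hm p (hC.frontier_subset hpC)).eq_of_not_lt ?_).symm⟩
    refine fun hpos => hpm.2 (mem_interior.2 ⟨{q : S2 | 0 < ⟪(m : E3), q⟫_ℝ}, ?_, ?_, hpos⟩)
    · exact fun q hq => (mem_hemisphere m q).2 (le_of_lt hq)
    · exact isOpen_lt continuous_const (by fun_prop)
  · rintro ⟨p, hp, h0⟩
    have hm' : m ∈ polar (hemisphere m) := subset_hemisphere_iff.1 subset_rfl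
    exact ⟨p, ⟨subset_closure hp, fun h => (inner_pos_of_mem_interior hm h).ne' h0⟩,
      subset_closure ((mem_hemisphere m p).2 h0.ge),
      fun h => (inner_pos_of_mem_interior hm' h).ne' h0⟩

/-- The cone over a convex body with apex at the origin. -/
def IsConvexBody.cone {C : Set S2} (hC : IsConvexBody C) : ProperCone ℝ E3 where
  toSubmodule := PointedCone.ofConeComb {x | ∃ r ∈ C, x = ‖x‖ • (r : E3)}
    (by
      obtain ⟨p, hp⟩ := hC.2.2
      exact ⟨p, p, interior_subset hp, by simp⟩)
    (by
      rintro x ⟨r, hr, hx⟩ y ⟨q, hq, hy⟩ a ha b hb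
      by_cases h0 : a • x + b • y = 0
      · exact ⟨r, hr, by simp [h0]⟩
      · refine ⟨unitVec _ h0, hC.2.1.2 r hr q hq ⟨‖a • x + b • y‖⁻¹ * (a * ‖x‖),
          ‖a • x + b • y‖⁻¹ * (b * ‖y‖), by positivity, by positivity, ?_⟩, ?_⟩
        · rw [mul_smul, mul_smul, mul_smul, mul_smul, ← hx, ← hy, ← smul_add]
          rfl
        · exact (smul_inv_smul₀ (norm_ne_zero_iff.2 h0) _).symm)
  isClosed' := by
    have hclosed : IsClosed {q : E3 × S2 | q.2 ∈ C ∧ q.1 = ‖q.1‖ • (q.2 : E3)} :=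
      (hC.1.preimage continuous_snd).inter (isClosed_eq (by fun_prop) (by fun_prop))
    convert! isClosedMap_fst_of_compactSpace _ hclosed using 1
    ext x
    simp

lemma IsConvexBody.mem_cone_iff {C : Set S2} (hC : IsConvexBody C) {x : E3} :
    x ∈ hC.cone ↔ ∃ r ∈ C, x = ‖x‖ • (r : E3) := Iff.rfl

lemma IsConvexBody.coe_mem_cone_iff {C : Set S2} (hC : IsConvexBody C) {p : S2} :
    (p : E3) ∈ hC.cone ↔ p ∈ C := by
  simp [hC.mem_cone_iff, Subtype.coe_inj]

lemma IsConvexBody.mem_of_forall_polar {C : Set S2} (hC : IsConvexBody C) {p : S2}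
    (h : ∀ y ∈ polar C, 0 ≤ ⟪(y : E3), p⟫_ℝ) : p ∈ C := by
  by_contra hp
  obtain ⟨y, hy, hyp⟩ := hC.cone.hyperplane_separation' (mt hC.coe_mem_cone_iff.1 hp)
  rw [real_inner_comm] at hyp
  have hy0 : y ≠ 0 := by
    rintro rfl
    simp at hyp
  refine (h (unitVec y hy0) fun r hr => ?_).not_gt ?_ <;> rw [inner_unitVec]
  · rw [real_inner_comm]
    exact mul_nonneg (by positivity) (hy r (hC.coe_mem_cone_iff.2 hr))
  · exact mul_neg_of_pos_of_neg (by positivity) hyp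

lemma IsConvexBody.exists_forall_inner_pos {C : Set S2} (hC : IsConvexBody C) :
    ∃ y : S2, ∀ p ∈ C, 0 < ⟪(y : E3), p⟫_ℝ := by
  obtain ⟨y, -, hy⟩ : ∃ y : E3, (∀ p ∈ C, 0 ≤ ⟪y, (p : E3)⟫_ℝ) ∧
      ∀ p ∈ C ∩ C, 0 < ⟪y, (p : E3)⟫_ℝ := by
    refine hC.1.isCompact.induction_on
      (p := fun s => ∃ y : E3, (∀ p ∈ C, 0 ≤ ⟪y, (p : E3)⟫_ℝ) ∧
        ∀ p ∈ s ∩ C, 0 < ⟪y, (p : E3)⟫_ℝ) ⟨0, by simp⟩ ?_ ?_ ?_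
    · rintro s t hst ⟨y, hyC, hyt⟩
      exact ⟨y, hyC, fun p hp => hyt p ⟨hst hp.1, hp.2⟩⟩
    · rintro s t ⟨y, hyC, hys⟩ ⟨z, hzC, hzt⟩
      refine ⟨y + z, fun p hp => ?_, fun p hp => ?_⟩ <;> rw [inner_add_left]
      · exact add_nonneg (hyC p hp) (hzC p hp)
      · rcases hp with ⟨hps | hpt, hpC⟩
        · exact add_pos_of_pos_of_nonneg (hys p ⟨hps, hpC⟩) (hzC p hpC)
        · exact add_pos_of_nonneg_of_pos (hyC p hpC) (hzt p ⟨hpt, hpC⟩)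
    · intro p hp
      have hneg : ¬ ∀ y ∈ polar C, 0 ≤ ⟪(y : E3), ((-p : S2) : E3)⟫_ℝ :=
        fun h => hC.2.1.1 p hp (hC.mem_of_forall_polar h)
      push Not at hneg
      obtain ⟨y, hy, hyp⟩ := hneg
      rw [coe_neg_sphere, inner_neg_right, neg_lt_zero] at hyp
      have hopen : IsOpen {q : S2 | 0 < ⟪(y : E3), q⟫_ℝ} := isOpen_lt continuous_const (by fun_prop)
      exact ⟨_, mem_nhdsWithin_of_mem_nhds (hopen.mem_nhds hyp), y, hy, fun q hq => hq.1⟩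
  obtain ⟨p, hp⟩ := hC.2.2
  have hy0 : y ≠ 0 := by
    rintro rfl
    simpa using hy p ⟨interior_subset hp, interior_subset hp⟩
  refine ⟨unitVec y hy0, fun q hq => ?_⟩
  rw [inner_unitVec]
  exact mul_pos (by positivity) (hy q ⟨hq, hq⟩)

/-! ### Lunes of least thickness -/

/-- The hemispheres centered at `k` and `m` contain `C`, and their lune has the least thickness
among such lunes; the thickness of a lune increases with the inner product of the centers of its
hemispheres. -/
structure IsDiametral (C : Set S2) (k m : S2) : Prop where
  left_mem : k ∈ polar C
  right_mem : m ∈ polar C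
  inner_le : ∀ a ∈ polar C, ∀ b ∈ polar C, ⟪(k : E3), m⟫_ℝ ≤ ⟪(a : E3), b⟫_ℝ

section Diametral

variable {C : Set S2} {k m : S2}

lemma IsDiametral.symm (h : IsDiametral C k m) : IsDiametral C m k :=
  ⟨h.right_mem, h.left_mem, fun a ha b hb => (real_inner_comm _ _).trans_le (h.inner_le a ha b hb)⟩

lemma IsConvexBody.exists_isDiametral (hC : IsConvexBody C) : ∃ k m, IsDiametral C k m := by
  obtain ⟨y, hy⟩ := hC.exists_forall_inner_pos
  have hyC : y ∈ polar C := fun p hp => (hy p hp).le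
  have hcompact := (isClosed_polar C).isCompact
  obtain ⟨⟨k, m⟩, ⟨hk, hm⟩, hmin⟩ := (hcompact.prod hcompact).exists_isMinOn ⟨(y, y), hyC, hyC⟩
    (f := fun q : S2 × S2 => ⟪(q.1 : E3), (q.2 : E3)⟫_ℝ) (by fun_prop)
  exact ⟨k, m, hk, hm, fun a ha b hb => hmin (show (a, b) ∈ polar C ×ˢ polar C from ⟨ha, hb⟩)⟩

lemma IsDiametral.ne (h : IsDiametral C k m) (hC : IsConvexBody C) : m ≠ k := by
  rintro rfl
  obtain ⟨y, hy⟩ := hC.exists_forall_inner_pos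
  obtain ⟨z, hz₁, hz₂⟩ := exists_ne_ne_neg y
  obtain ⟨a, ha, hlt⟩ := exists_mem_polar_inner_lt hC.1 hy hz₁ hz₂
  have hay : a ≠ y := by
    rintro rfl
    exact hlt.false
  have := h.inner_le a ha y fun p hp => (hy p hp).le
  rw [inner_coe_self] at this
  exact this.not_gt (inner_coe_lt_one hay)

lemma IsDiametral.ne_neg (h : IsDiametral C k m) (hC : IsConvexBody C) : m ≠ -k :=
  hC.ne_neg_of_mem_polar h.right_mem h.left_mem

lemma IsDiametral.supports_left (h : IsDiametral C k m) (hC : IsConvexBody C) : Supports k C := by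
  refine (supports_iff hC.1).2 ⟨h.left_mem, ?_⟩
  by_contra! hne
  obtain ⟨a, ha, hlt⟩ := exists_mem_polar_inner_lt hC.1
    (fun p hp => (h.left_mem p hp).lt_of_ne' (hne p hp)) (h.ne hC) (h.ne_neg hC)
  exact hlt.not_ge (h.inner_le a ha m h.right_mem)

lemma IsDiametral.luneThickness_le (h : IsDiametral C k m) (hC : IsConvexBody C) {a b : S2}
    (ha : a ∈ polar C) (hb : b ∈ polar C) (hba : b ≠ a) :
    luneThickness k m ≤ luneThickness a b := by
  rw [luneThickness_eq (h.ne hC) (h.ne_neg hC),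
    luneThickness_eq hba (hC.ne_neg_of_mem_polar hb ha)]
  exact arccos_le_arccos (neg_le_neg (h.inner_le a ha b hb))

lemma IsDiametral.luneThickness_le_width (h : IsDiametral C k m) (hC : IsConvexBody C) {a : S2}
    (ha : a ∈ polar C) : luneThickness k m ≤ width a C := by
  refine le_csInf ?_ ?_
  · obtain ⟨b, hb, hbC, hba⟩ : ∃ b, Supports b C ∧ b ∈ polar C ∧ b ≠ a := by
      by_cases hma : m = a
      · exact ⟨k, h.supports_left hC, h.left_mem, hma ▸ (h.ne hC).symm⟩
      · exact ⟨m, h.symm.supports_left hC, h.right_mem, hma⟩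
    exact ⟨_, b, hb, hba, hC.ne_neg_of_mem_polar hbC ha, rfl⟩
  · rintro w ⟨b, hb, hba, -, rfl⟩
    exact h.luneThickness_le hC ha ((supports_iff hC.1).1 hb).1 hba

lemma IsDiametral.thickness_eq (h : IsDiametral C k m) (hC : IsConvexBody C) :
    thickness C = luneThickness k m := by
  have hlow : ∀ a, Supports a C → luneThickness k m ≤ width a C := fun a ha =>
    h.luneThickness_le_width hC ((supports_iff hC.1).1 ha).1
  have hwidth : width k C ≤ luneThickness k m := by
    refine csInf_le ⟨0, ?_⟩ ⟨m, h.symm.supports_left hC, h.ne hC, h.ne_neg hC, rfl⟩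
    rintro w ⟨b, -, -, -, rfl⟩
    exact InnerProductGeometry.angle_nonneg _ _
  refine le_antisymm (le_trans (csInf_le ⟨luneThickness k m, ?_⟩ ?_) hwidth) (le_csInf ?_ ?_)
  · rintro w ⟨a, ha, rfl⟩
    exact hlow a ha
  · exact ⟨k, h.supports_left hC, rfl⟩
  · exact ⟨_, k, h.supports_left hC, rfl⟩
  · rintro w ⟨a, ha, rfl⟩
    exact hlow a ha

lemma IsDiametral.inner_eq (h : IsDiametral C k m) (hC : IsConvexBody C) :
    ⟪(k : E3), m⟫_ℝ = -cos (thickness C) := by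
  rw [h.thickness_eq hC, luneThickness_eq (h.ne hC) (h.ne_neg hC), cos_arccos, neg_neg]
  · linarith [inner_coe_le_one k m]
  · linarith [neg_one_le_inner_coe k m]

lemma IsConvexBody.thickness_mem_Ioo (hC : IsConvexBody C) : thickness C ∈ Ioo 0 π := by
  obtain ⟨k, m, h⟩ := hC.exists_isDiametral
  rw [h.thickness_eq hC, luneThickness_eq (h.ne hC) (h.ne_neg hC)]
  refine ⟨arccos_pos.2 ?_, (arccos_le_pi _).lt_of_ne fun hπ => ?_⟩
  · linarith [neg_one_lt_inner_coe fun hkm : k = -m => h.ne_neg hC (by rw [hkm, neg_neg])]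
  · linarith [arccos_eq_pi.1 hπ, inner_coe_lt_one (h.ne hC).symm]

lemma IsConvexBody.sin_thickness_pos (hC : IsConvexBody C) : 0 < sin (thickness C) :=
  sin_pos_of_mem_Ioo hC.thickness_mem_Ioo

lemma IsConvexBody.neg_cos_thickness_le_inner (hC : IsConvexBody C) (hk : k ∈ polar C)
    (hm : m ∈ polar C) : -cos (thickness C) ≤ ⟪(k : E3), m⟫_ℝ := by
  obtain ⟨a, b, h⟩ := hC.exists_isDiametral
  exact (h.inner_eq hC).ge.trans (h.inner_le k hk m hm)

lemma IsConvexBody.isDiametral_of_inner_le (hC : IsConvexBody C) (hk : k ∈ polar C)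
    (hm : m ∈ polar C) (hkm : ⟪(k : E3), m⟫_ℝ ≤ -cos (thickness C)) : IsDiametral C k m :=
  ⟨hk, hm, fun _ ha _ hb => hkm.trans (hC.neg_cos_thickness_le_inner ha hb)⟩

lemma IsConvexBody.neg_cos_thickness_lt_inner (hC : IsConvexBody C)
    (hk : ∀ p ∈ C, 0 < ⟪(k : E3), p⟫_ℝ) (hm : m ∈ polar C) :
    -cos (thickness C) < ⟪(k : E3), m⟫_ℝ := by
  by_contra! hle
  have h := hC.isDiametral_of_inner_le (fun p hp => (hk p hp).le) hm hle
  obtain ⟨p, hp, h0⟩ := ((supports_iff hC.1).1 (h.supports_left hC)).2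
  exact (hk p hp).ne' h0

lemma inner_mul_inner_le_of_forall_mul_norm_le {F : Type*} [NormedAddCommGroup F]
    [InnerProductSpace ℝ F] {k m y : F} (hm : ‖m‖ = 1)
    (h : ∀ t > (0 : ℝ), ⟪k, m⟫_ℝ * ‖m + t • y‖ ≤ ⟪k, m + t • y⟫_ℝ) :
    ⟪k, m⟫_ℝ * ⟪m, y⟫_ℝ ≤ ⟪k, y⟫_ℝ := by
  have hline : HasDerivAt (fun t : ℝ => m + t • y) y 0 := by
    simpa using ((hasDerivAt_id (0 : ℝ)).smul_const y).const_add m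
  have hnorm : HasDerivAt (fun t : ℝ => ‖m + t • y‖) ⟪m, y⟫_ℝ 0 := by
    simpa [hm] using hline.norm_sq.sqrt (by simp [hm])
  have hinner : HasDerivAt (fun t : ℝ => ⟪k, m + t • y⟫_ℝ) ⟪k, y⟫_ℝ 0 := by
    simpa using (hasDerivAt_const (0 : ℝ) k).inner ℝ hline
  have hslope := (hinner.sub (hnorm.const_mul ⟪k, m⟫_ℝ)).tendsto_slope_zero_right
  refine sub_nonneg.1 (ge_of_tendsto hslope (Filter.eventually_of_mem self_mem_nhdsWithin ?_))
  intro t ht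
  simpa [hm] using mul_nonneg (inv_pos.2 ht).le (sub_nonneg.2 (h t ht))

lemma IsDiametral.exists_mem_eq_semicircleCenter (h : IsDiametral C k m) (hC : IsConvexBody C) :
    ∃ q ∈ C, (q : E3) = semicircleCenter k m := by
  refine ⟨⟨semicircleCenter k m, by simp [(semicircleCenter_spec k m (h.ne hC) (h.ne_neg hC)).1]⟩,
    hC.mem_of_forall_polar fun y hy => ?_, rfl⟩
  have hvar : ⟪(m : E3), k⟫_ℝ * ⟪(k : E3), y⟫_ℝ ≤ ⟪(m : E3), y⟫_ℝ := by
    refine inner_mul_inner_le_of_forall_mul_norm_le (norm_eq_of_mem_sphere k) fun t ht => ?_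
    rcases eq_or_ne ((k : E3) + t • (y : E3)) 0 with h0 | h0
    · simp [h0]
    have hmem : unitVec _ h0 ∈ polar C := fun p hp => by
      rw [inner_unitVec, inner_add_left, real_inner_smul_left]
      have := h.left_mem p hp
      have := hy p hp
      positivity
    have := h.symm.inner_le m h.right_mem _ hmem
    rwa [inner_unitVec_right, le_inv_mul_iff₀ (norm_pos_iff.2 h0), mul_comm] at this
  change 0 ≤ ⟪(y : E3), semicircleCenter k m⟫_ℝ
  rw [semicircleCenter, real_inner_smul_right, inner_sub_right, real_inner_smul_right,
    real_inner_comm (m : E3) (y : E3), real_inner_comm (k : E3) (y : E3),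
    real_inner_comm (m : E3) (k : E3)]
  exact mul_nonneg (by positivity) (sub_nonneg.2 hvar)

end Diametral

/-! ### Reduced bodies and their exposed points -/

/-- The part of `R` in the closed half-space with inner normal `z`. -/
def cut (R : Set S2) (z : E3) : Set S2 := {r ∈ R | 0 ≤ ⟪z, (r : E3)⟫_ℝ}

section Exposed

variable {R : Set S2} {x z : E3} {e : S2}

lemma IsConvexBody.isConvexBody_cut {p : S2} (hR : IsConvexBody R) (hp : p ∈ interior R)
    (hzp : 0 < ⟪z, (p : E3)⟫_ℝ) : IsConvexBody (cut R z) := by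
  refine ⟨hR.1.and (isClosed_le continuous_const (by fun_prop)), ⟨?_, ?_⟩, p, ?_⟩
  · exact fun a ha h => hR.2.1.1 a ha.1 h.1
  · rintro a ⟨ha, hza⟩ b ⟨hb, hzb⟩ q hq
    refine ⟨hR.2.1.2 a ha b hb hq, ?_⟩
    obtain ⟨s, t, hs, ht, h⟩ := hq
    rw [h, inner_add_right, real_inner_smul_right, real_inner_smul_right]
    positivity
  · refine mem_interior.2 ⟨interior R ∩ {q : S2 | 0 < ⟪z, (q : E3)⟫_ℝ},
      fun q hq => ⟨interior_subset hq.1, le_of_lt hq.2⟩, ?_, hp, hzp⟩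
    exact isOpen_interior.inter (isOpen_lt continuous_const (by fun_prop))

lemma IsConvexBody.mem_polar_of_mem_polar_cut (hR : IsConvexBody R) {k q : S2}
    (hk : k ∈ polar (cut R z)) (hq : q ∈ R) (hkq : ⟪(k : E3), q⟫_ℝ = 0)
    (hzq : 0 < ⟪z, (q : E3)⟫_ℝ) : k ∈ polar R := by
  intro r hr
  obtain ⟨t, ht, hsmall⟩ : ∃ t > 0, 0 < ⟪z, (q : E3)⟫_ℝ + t * ⟪z, (r : E3)⟫_ℝ := by
    refine ⟨⟪z, (q : E3)⟫_ℝ / (1 + |⟪z, (r : E3)⟫_ℝ|), by positivity, ?_⟩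
    rw [div_mul_eq_mul_div, ← mul_div_assoc', ← mul_one_add]
    refine mul_pos hzq ?_
    rw [← sub_neg_eq_add, ← neg_div, sub_pos, div_lt_one (by positivity)]
    linarith [neg_abs_le ⟪z, (r : E3)⟫_ℝ]
  obtain ⟨y, hy, hqy⟩ := hR.mem_cone_iff.1 <|
    hR.cone.add_mem (hR.coe_mem_cone_iff.2 hq) (hR.cone.smul_mem (hR.coe_mem_cone_iff.2 hr) ht.le)
  set n := ‖(q : E3) + t • (r : E3)‖
  have hzy : n * ⟪z, (y : E3)⟫_ℝ = ⟪z, (q : E3)⟫_ℝ + t * ⟪z, (r : E3)⟫_ℝ := by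
    rw [← real_inner_smul_right, ← hqy, inner_add_right, real_inner_smul_right]
  have hky : n * ⟪(k : E3), y⟫_ℝ = t * ⟪(k : E3), r⟫_ℝ := by
    rw [← real_inner_smul_right, ← hqy, inner_add_right, real_inner_smul_right, hkq, zero_add]
  have hyZ : y ∈ cut R z :=
    ⟨hy, (pos_of_mul_pos_right (hzy ▸ hsmall) (norm_nonneg _)).le⟩
  exact nonneg_of_mul_nonneg_right (hky ▸ mul_nonneg (norm_nonneg _) (hk y hyZ)) ht

/-- A hemisphere of a least lune of the cut body that does not contain `R` can touch the cut body
only on the cut: elsewhere `R` could not extend beyond that hemisphere. -/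
lemma IsReduced.exists_inner_le_of_cut (hR : IsReduced R) (he : e ∈ R) (hze : ⟪z, (e : E3)⟫_ℝ < 0)
    {p : S2} (hp : p ∈ interior R) (hzp : 0 < ⟪z, (p : E3)⟫_ℝ) :
    ∃ k ∈ polar (cut R z), ∃ m ∈ polar (cut R z), ⟪(k : E3), m⟫_ℝ ≤ -cos (thickness R) ∧
      ∃ q ∈ cut R z, ⟪z, (q : E3)⟫_ℝ = 0 ∧ (q : E3) = semicircleCenter k m := by
  have hZ : IsConvexBody (cut R z) := hR.1.isConvexBody_cut hp hzp
  have hlt : thickness (cut R z) < thickness R := hR.2 _ hZ (fun r hr => hr.1) fun h =>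
    hze.not_ge (h.symm.subset he).2
  have hcos : cos (thickness R) < cos (thickness (cut R z)) :=
    cos_lt_cos_of_nonneg_of_le_pi hZ.thickness_mem_Ioo.1.le hR.1.thickness_mem_Ioo.2.le hlt
  obtain ⟨k, m, h⟩ := hZ.exists_isDiametral
  have hkm : ⟪(k : E3), m⟫_ℝ < -cos (thickness R) := by rw [h.inner_eq hZ]; exact neg_lt_neg hcos
  wlog hk : k ∉ polar R generalizing k m
  · refine this m k h.symm (by rwa [real_inner_comm]) fun hm => hkm.not_ge ?_
    exact hR.1.neg_cos_thickness_le_inner (not_not.1 hk) hm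
  obtain ⟨q, hq, hqe⟩ := h.exists_mem_eq_semicircleCenter hZ
  refine ⟨k, h.left_mem, m, h.right_mem, hkm.le, q, hq, ?_, hqe⟩
  by_contra hne
  refine hk (hR.1.mem_polar_of_mem_polar_cut h.left_mem hq.1 ?_ (hq.2.lt_of_ne' hne))
  rw [hqe, (semicircleCenter_spec k m (h.ne hZ) (h.ne_neg hZ)).2.1]

lemma mem_polar_of_tendsto_cut {l : Filter ℝ} [l.NeBot] (hl : l ≤ nhds 0)
    (hx : ∀ r ∈ R, r ≠ e → 0 < ⟪x, (r : E3)⟫_ℝ) {a q : ℝ → S2} {a₀ : S2}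
    (ha : ∀ᶠ ε in l, a ε ∈ polar (cut R (x - ε • (e : E3))))
    (haq : ∀ᶠ ε in l, 0 ≤ ⟪(a ε : E3), q ε⟫_ℝ)
    (ha₀ : Filter.Tendsto a l (nhds a₀)) (hq : Filter.Tendsto q l (nhds e)) : a₀ ∈ polar R := by
  intro r hr
  rcases eq_or_ne r e with rfl | hre
  · exact ge_of_tendsto (((continuous_subtype_val.tendsto _).comp ha₀).inner
      ((continuous_subtype_val.tendsto _).comp hq)) haq
  have hcut : ∀ᶠ ε in l, r ∈ cut R (x - ε • (e : E3)) := by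
    have hcont : Continuous fun ε : ℝ => ⟪x - ε • (e : E3), (r : E3)⟫_ℝ := by fun_prop
    have hpos : 0 < ⟪x - (0 : ℝ) • (e : E3), (r : E3)⟫_ℝ := by simpa using hx r hr hre
    filter_upwards [hl (hcont.continuousAt.eventually_const_lt hpos)] with ε hε
    exact ⟨hr, le_of_lt hε⟩
  refine ge_of_tendsto (((continuous_subtype_val.tendsto _).comp ha₀).inner
    (tendsto_const_nhds (x := (r : E3)))) ?_
  filter_upwards [ha, hcut] with ε haε hrε using haε r hrε

lemma IsReduced.eventually_exists_inner_le_of_cut (hR : IsReduced R) (he : e ∈ R) (hx0 : x ≠ 0)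
    (hxe : ⟪x, (e : E3)⟫_ℝ = 0) (hx : ∀ r ∈ R, r ≠ e → 0 < ⟪x, (r : E3)⟫_ℝ) :
    ∀ᶠ ε in nhdsWithin (0 : ℝ) (Ioi 0), ∃ w : S2 × S2 × S2,
      w.1 ∈ polar (cut R (x - ε • (e : E3))) ∧ w.2.1 ∈ polar (cut R (x - ε • (e : E3))) ∧
      ⟪(w.1 : E3), w.2.1⟫_ℝ ≤ -cos (thickness R) ∧ w.2.2 ∈ cut R (x - ε • (e : E3)) ∧
      ⟪x - ε • (e : E3), w.2.2⟫_ℝ = 0 ∧ (w.2.2 : E3) = semicircleCenter w.1 w.2.1 := by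
  obtain ⟨p, hp, hxp⟩ := exists_mem_open_inner_ne_zero isOpen_interior hR.1.2.2 hx0
  have hcont : Continuous fun ε : ℝ => ⟪x - ε • (e : E3), (p : E3)⟫_ℝ := by fun_prop
  have hpos : 0 < ⟪x - (0 : ℝ) • (e : E3), (p : E3)⟫_ℝ := by
    simpa using hx p (interior_subset hp) fun h => hxp (h ▸ hxe)
  filter_upwards [nhdsWithin_le_nhds (hcont.continuousAt.eventually_const_lt hpos),
    self_mem_nhdsWithin] with ε hε hε0
  obtain ⟨k, hk, m, hm, hkm, q, hq, hq0, hqe⟩ := hR.exists_inner_le_of_cut he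
    (by simpa [inner_sub_left, real_inner_smul_left, hxe] using hε0) hp hε
  exact ⟨(k, m, q), hk, hm, hkm, hq, hq0, hqe⟩

/-- Cut off smaller and smaller caps around the exposed point and pass to the limit of the lunes
of least thickness of the cut bodies. -/
lemma IsReduced.exists_isDiametral_of_exposed (hR : IsReduced R) (he : e ∈ R) (hx0 : x ≠ 0)
    (hxe : ⟪x, (e : E3)⟫_ℝ = 0) (hx : ∀ r ∈ R, r ≠ e → 0 < ⟪x, (r : E3)⟫_ℝ) :
    ∃ k m, IsDiametral R k m ∧ (e : E3) = semicircleCenter k m := by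
  have : Nonempty (S2 × S2 × S2) := ⟨(e, e, e)⟩
  obtain ⟨w, hw⟩ := Filter.skolem.1 (hR.eventually_exists_inner_le_of_cut he hx0 hxe hx)
  obtain ⟨⟨k, m, q⟩, hclus⟩ := exists_clusterPt_of_compactSpace
    (Filter.map w (nhdsWithin (0 : ℝ) (Ioi 0)))
  obtain ⟨U, hU, hlim⟩ := mapClusterPt_iff_ultrafilter.1 hclus
  replace hw := hw.filter_mono hU
  have hU0 : (U : Filter ℝ) ≤ nhds 0 := hU.trans nhdsWithin_le_nhds
  have hqlim := hlim.snd_nhds.snd_nhds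
  have hq : q ∈ R := hR.1.1.mem_of_tendsto hqlim (hw.mono fun ε h => h.2.2.2.1.1)
  have hxq : ⟪x, (q : E3)⟫_ℝ = 0 := by
    have hcont : Continuous fun v : ℝ × S2 => ⟪x - v.1 • (e : E3), (v.2 : E3)⟫_ℝ := by fun_prop
    have htend := (hcont.tendsto (0, q)).comp
      ((Filter.tendsto_id.mono_left hU0).prodMk_nhds hqlim)
    simpa using tendsto_nhds_unique htend
      (tendsto_const_nhds.congr' (hw.mono fun ε h => h.2.2.2.2.1.symm))
  obtain rfl : q = e := of_not_not fun hne => (hx q hq hne).ne' hxq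
  have hk : k ∈ polar R := mem_polar_of_tendsto_cut hU0 hx (hw.mono fun ε h => h.1)
    (hw.mono fun ε h => h.1 _ h.2.2.2.1) hlim.fst_nhds hqlim
  have hm : m ∈ polar R := mem_polar_of_tendsto_cut hU0 hx (hw.mono fun ε h => h.2.1)
    (hw.mono fun ε h => h.2.1 _ h.2.2.2.1) hlim.snd_nhds.fst_nhds hqlim
  have hclosed : IsClosed {v : S2 × S2 × S2 | ⟪(v.1 : E3), v.2.1⟫_ℝ ≤ -cos (thickness R) ∧
      √(1 - ⟪(v.1 : E3), v.2.1⟫_ℝ ^ 2) • (v.2.2 : E3) =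
        (v.2.1 : E3) - ⟪(v.1 : E3), v.2.1⟫_ℝ • (v.1 : E3)} :=
    (isClosed_le (by fun_prop) (by fun_prop)).and (isClosed_eq (by fun_prop) (by fun_prop))
  obtain ⟨hkm, heq⟩ := hclosed.mem_of_tendsto hlim (hw.mono fun ε h =>
    ⟨h.2.2.1, by rw [h.2.2.2.2.2, sub_inner_smul_eq_semicircleCenter]⟩)
  have h := hR.1.isDiametral_of_inner_le hk hm hkm
  refine ⟨k, m, h, ?_⟩
  rw [sub_inner_smul_eq_semicircleCenter] at heq
  refine smul_right_injective E3 (sqrt_pos.2 ?_).ne' heq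
  exact sub_pos.2 (inner_sq_lt_one (h.ne hR.1) (h.ne_neg hR.1))

lemma IsDiametral.coe_right_eq {k m : S2} (h : IsDiametral R k m) (hR : IsConvexBody R) :
    (m : E3) = sin (thickness R) • semicircleCenter k m - cos (thickness R) • (k : E3) := by
  have hcenter := sub_inner_smul_eq_semicircleCenter k m
  rw [h.inner_eq hR, neg_sq, ← sin_sq, sqrt_sq hR.sin_thickness_pos.le, neg_smul,
    sub_neg_eq_add] at hcenter
  exact eq_sub_of_add_eq hcenter

lemma IsDiametral.exists_mem_eq_cos_smul_add_sin_smul {k m : S2} (h : IsDiametral R k m)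
    (hR : IsConvexBody R) : ∃ b ∈ R, (b : E3) =
      cos (thickness R) • semicircleCenter k m + sin (thickness R) • (k : E3) := by
  obtain ⟨b, hb, hbe⟩ := h.symm.exists_mem_eq_semicircleCenter hR
  refine ⟨b, hb, ?_⟩
  have hk := h.symm.coe_right_eq hR
  rw [h.coe_right_eq hR, ← hbe] at hk
  refine smul_right_injective E3 hR.sin_thickness_pos.ne' ?_
  refine (eq_add_of_sub_eq hk.symm).trans ?_
  match_scalars
  · linear_combination -sin_sq_add_cos_sq (thickness R)
  · ring

end Exposed

/-! ### Linked lunes -/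

/-- The cross product of vectors of Euclidean space. -/
noncomputable def cross (a b : E3) : E3 := WithLp.toLp 2 (crossProduct a.ofLp b.ofLp)

/-- The triple product `⟪a, b × c⟫`, an oriented volume. -/
noncomputable def tripleProduct (a b c : E3) : ℝ := ⟪a, cross b c⟫_ℝ

lemma tripleProduct_eq (a b c : E3) : tripleProduct a b c =
    a 0 * (b 1 * c 2 - b 2 * c 1) + a 1 * (b 2 * c 0 - b 0 * c 2) +
      a 2 * (b 0 * c 1 - b 1 * c 0) := by
  simp [tripleProduct, cross, cross_apply, PiLp.inner_apply, Fin.sum_univ_three, mul_comm]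

lemma inner_eq_sum (a b : E3) : ⟪a, b⟫_ℝ = a 0 * b 0 + a 1 * b 1 + a 2 * b 2 := by
  simp [PiLp.inner_apply, Fin.sum_univ_three, mul_comm]

lemma tripleProduct_rotate (a b c : E3) : tripleProduct a b c = tripleProduct b c a := by
  simp only [tripleProduct_eq]
  ring

lemma tripleProduct_swap (a b c : E3) : tripleProduct b a c = -tripleProduct a b c := by
  simp only [tripleProduct_eq]
  ring

lemma tripleProduct_mul_tripleProduct (a b c x y z : E3) :
    tripleProduct a b c * tripleProduct x y z =
      ⟪a, x⟫_ℝ * (⟪b, y⟫_ℝ * ⟪c, z⟫_ℝ - ⟪b, z⟫_ℝ * ⟪c, y⟫_ℝ) -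
      ⟪a, y⟫_ℝ * (⟪b, x⟫_ℝ * ⟪c, z⟫_ℝ - ⟪b, z⟫_ℝ * ⟪c, x⟫_ℝ) +
      ⟪a, z⟫_ℝ * (⟪b, x⟫_ℝ * ⟪c, y⟫_ℝ - ⟪b, y⟫_ℝ * ⟪c, x⟫_ℝ) := by
  simp only [tripleProduct_eq, inner_eq_sum]
  ring

lemma tripleProduct_mul_inner (a b c x y : E3) : tripleProduct a b c * ⟪x, y⟫_ℝ =
    tripleProduct b c x * ⟪a, y⟫_ℝ + tripleProduct c a x * ⟪b, y⟫_ℝ +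
      tripleProduct a b x * ⟪c, y⟫_ℝ := by
  simp only [tripleProduct_eq, inner_eq_sum]
  ring

lemma inner_cross_cross (a b : E3) :
    ⟪cross a b, cross a b⟫_ℝ = ⟪a, a⟫_ℝ * ⟪b, b⟫_ℝ - ⟪a, b⟫_ℝ ^ 2 := by
  simp only [inner_eq_sum, cross, cross_apply]
  simp
  ring

lemma inner_sq_add_inner_sq_le {x y : S2} (hxy : ⟪(x : E3), y⟫_ℝ = 0) (v : E3) :
    ⟪(x : E3), v⟫_ℝ ^ 2 + ⟪(y : E3), v⟫_ℝ ^ 2 ≤ ⟪v, v⟫_ℝ := by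
  have hon : Orthonormal ℝ ![(x : E3), y] := by
    simp [orthonormal_vecCons_iff, hxy]
  have := hon.sum_inner_products_le (s := Finset.univ) v
  rw [real_inner_self_eq_norm_sq]
  simpa [sq_abs] using this

lemma tripleProduct_sq_add_sq_le (a b : S2) {x y : S2} (hxy : ⟪(x : E3), y⟫_ℝ = 0) :
    tripleProduct a b x ^ 2 + tripleProduct a b y ^ 2 ≤ 1 - ⟪(a : E3), b⟫_ℝ ^ 2 := by
  have := inner_sq_add_inner_sq_le hxy (cross a b)
  rw [inner_cross_cross, inner_coe_self, inner_coe_self, one_mul] at this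
  rwa [← tripleProduct_rotate (x : E3) a b, ← tripleProduct_rotate (y : E3) a b]

/-- The cone over the lune of thickness `δ` cut out by `k` and `sin δ • e - cos δ • k`: when
`⟪k, e⟫ = 0`, the semicircle bounding `H(k)` has center `e`. -/
def lune (δ : ℝ) (e k : S2) : Set E3 :=
  {x | 0 ≤ ⟪(k : E3), x⟫_ℝ ∧ 0 ≤ ⟪sin δ • (e : E3) - cos δ • (k : E3), x⟫_ℝ}

/-- Lunes of thickness `δ`, the `i`-th one bounded by a semicircle with center `e i` on the great
circle with pole `k i`, each of which contains the centers `e j` and `cos δ • e j + sin δ • k j` of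
the two semicircles that bound any other. -/
structure LinkedLunes {ι : Type*} (δ : ℝ) (e k : ι → S2) : Prop where
  orth : ∀ i, ⟪(k i : E3), e i⟫_ℝ = 0
  left_mem : ∀ i j, (e j : E3) ∈ lune δ (e i) (k i)
  right_mem : ∀ i j, cos δ • (e j : E3) + sin δ • (k j : E3) ∈ lune δ (e i) (k i)

lemma cos_mul_inner_le_of_mem_lune {δ : ℝ} {e k : S2} {x : E3} (hx : x ∈ lune δ e k) :
    cos δ * ⟪(k : E3), x⟫_ℝ ≤ sin δ * ⟪(e : E3), x⟫_ℝ := by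
  have := hx.2
  rwa [inner_sub_left, real_inner_smul_left, real_inner_smul_left, sub_nonneg] at this

lemma inner_sq_le_sin_sq_of_mem_lune {δ : ℝ} {e k x : S2} (hc : 0 ≤ cos δ)
    (hke : ⟪(k : E3), e⟫_ℝ = 0) (hx : (x : E3) ∈ lune δ e k) :
    ⟪(k : E3), x⟫_ℝ ^ 2 ≤ sin δ ^ 2 := by
  have hle := pow_le_pow_left₀ (mul_nonneg hc hx.1) (cos_mul_inner_le_of_mem_lune hx) 2
  have hsum := inner_sq_add_inner_sq_le hke x
  rw [inner_coe_self] at hsum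
  nlinarith [sin_sq_add_cos_sq δ, mul_le_mul_of_nonneg_left hsum (sq_nonneg (sin δ))]

lemma mul_le_mul_sq_of_mul_le {s c L p q Y z : ℝ} (hs : 0 < s) (hp : 0 ≤ p) (hq : 0 ≤ q)
    (hz : q ^ 2 + z ^ 2 = 1 - L ^ 2) (hcq : c * q ≤ s * L)
    (h : s * (L * (p * q) + Y) ≤ c * p * (1 - L ^ 2)) : q * Y ≤ L * p * z ^ 2 := by
  have hℓ : 0 ≤ 1 - L ^ 2 := hz ▸ by positivity
  refine le_of_mul_le_mul_left ?_ hs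
  linear_combination q * h + p * (1 - L ^ 2) * hcq - s * L * p * hz

lemma sq_le_sq_of_sq_le_mul {a b : ℝ} (h : a ^ 2 ≤ b * a) : a ^ 2 ≤ b ^ 2 := by
  nlinarith [sq_nonneg (b - a)]

namespace LinkedLunes

variable {ι : Type*} {δ : ℝ} {e k : ι → S2}

lemma inner_sq_add_tripleProduct_sq (h : LinkedLunes δ e k) (i j : ι) :
    ⟪(k i : E3), e j⟫_ℝ ^ 2 + tripleProduct (e i) (e j) (k i) ^ 2 =
      1 - ⟪(e i : E3), e j⟫_ℝ ^ 2 := by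
  have := tripleProduct_mul_tripleProduct (e i) (e j) (k i) (e i) (e j) (k i)
  rw [real_inner_comm (k i : E3) (e i), real_inner_comm (k i : E3) (e j), h.orth,
    real_inner_comm (e i : E3) (e j), inner_coe_self, inner_coe_self, inner_coe_self] at this
  linear_combination this

lemma inner_mul_one_sub_sq (h : LinkedLunes δ e k) (i j : ι) :
    ⟪(k i : E3), k j⟫_ℝ * (1 - ⟪(e i : E3), e j⟫_ℝ ^ 2) =
      tripleProduct (e i) (e j) (k i) * tripleProduct (e i) (e j) (k j) -
        ⟪(e i : E3), e j⟫_ℝ * (⟪(k i : E3), e j⟫_ℝ * ⟪(k j : E3), e i⟫_ℝ) := by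
  have := tripleProduct_mul_tripleProduct (e i) (e j) (k i) (e i) (e j) (k j)
  rw [real_inner_comm (k j : E3) (e i), real_inner_comm (k j : E3) (e j), h.orth, h.orth,
    real_inner_comm (e i : E3) (e j), inner_coe_self, inner_coe_self] at this
  linear_combination -this

lemma inner_nonneg (h : LinkedLunes δ e k) (hs : 0 < sin δ) (hc : 0 ≤ cos δ) (i j : ι) :
    0 ≤ ⟪(e i : E3), e j⟫_ℝ :=
  nonneg_of_mul_nonneg_right
    ((mul_nonneg hc (h.left_mem i j).1).trans (cos_mul_inner_le_of_mem_lune (h.left_mem i j))) hs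

lemma cos_mul_add_sin_mul_nonneg (h : LinkedLunes δ e k) (i j : ι) :
    0 ≤ cos δ * ⟪(k i : E3), e j⟫_ℝ + sin δ * ⟪(k i : E3), k j⟫_ℝ := by
  have := (h.right_mem i j).1
  rwa [inner_add_right, real_inner_smul_right, real_inner_smul_right] at this

/-- The far semicircle centers of two linked lunes lie on the same side of the great circle through
`e i` and `e j`: the axes of the lunes cross. -/
lemma tripleProduct_mul_nonneg (h : LinkedLunes δ e k) (hs : 0 < sin δ) (i j : ι) :
    0 ≤ tripleProduct (e i) (e j) (k i) * tripleProduct (e i) (e j) (k j) := by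
  have hp := (h.left_mem i j).1
  have hq := (h.left_mem j i).1
  have hcp := cos_mul_inner_le_of_mem_lune (h.left_mem i j)
  have hcq := cos_mul_inner_le_of_mem_lune (h.left_mem j i)
  have hy := h.inner_sq_add_tripleProduct_sq i j
  have hz := h.inner_sq_add_tripleProduct_sq j i
  have hκ := h.inner_mul_one_sub_sq i j
  have hi := h.cos_mul_add_sin_mul_nonneg i j
  have hj := h.cos_mul_add_sin_mul_nonneg j i
  rw [tripleProduct_swap, neg_sq] at hz
  rw [real_inner_comm (e i : E3) (e j)] at hcq hz
  rw [real_inner_comm (k i : E3) (k j)] at hj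
  set L := ⟪(e i : E3), e j⟫_ℝ
  set p := ⟪(k i : E3), e j⟫_ℝ
  set q := ⟪(k j : E3), e i⟫_ℝ
  set y := tripleProduct (e i) (e j) (k i)
  set z := tripleProduct (e i) (e j) (k j)
  by_contra! hneg
  have hℓ : 0 < 1 - L ^ 2 := by
    have : y ≠ 0 := left_ne_zero_of_mul hneg.ne
    rw [← hy]
    positivity
  have hpY : sin δ * (L * (p * q) + -(y * z)) ≤ cos δ * p * (1 - L ^ 2) := by
    linear_combination mul_nonneg hi hℓ.le + sin δ * hκ
  have hqY : sin δ * (L * (q * p) + -(y * z)) ≤ cos δ * q * (1 - L ^ 2) := by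
    linear_combination mul_nonneg hj hℓ.le + sin δ * hκ
  have hqz := mul_le_mul_sq_of_mul_le hs hp hq hz hcq hpY
  have hpy := mul_le_mul_sq_of_mul_le hs hq hp hy hcp hqY
  have hpq : p * q * ((y * z) ^ 2 * (1 - L ^ 2)) ≤ 0 := by
    have := mul_le_mul hqz hpy (mul_nonneg hp (neg_pos.2 hneg).le)
      ((mul_nonneg hq (neg_pos.2 hneg).le).trans hqz)
    linear_combination this
  have hsY : 0 < sin δ * -(y * z) := mul_pos hs (neg_pos.2 hneg)
  have hpq0 : p * q = 0 :=
    le_antisymm (nonpos_of_mul_nonpos_left hpq (by have := hneg.ne; positivity)) (mul_nonneg hp hq)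
  rcases mul_eq_zero.1 hpq0 with hp0 | hq0
  · rw [hp0] at hpY
    linarith
  · rw [hq0] at hqY
    linarith

lemma cos_sq_le_inner (h : LinkedLunes δ e k) (hs : 0 < sin δ) (hc : 0 ≤ cos δ) (i j : ι) :
    cos δ ^ 2 ≤ ⟪(e i : E3), e j⟫_ℝ := by
  wlog hqp : ⟪(k j : E3), e i⟫_ℝ ≤ ⟪(k i : E3), e j⟫_ℝ generalizing i j
  · rw [real_inner_comm]
    exact this j i (le_of_not_ge hqp)
  have hL0 := h.inner_nonneg hs hc i j
  have hp := (h.left_mem i j).1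
  have hcp := cos_mul_inner_le_of_mem_lune (h.left_mem i j)
  have hyz := h.tripleProduct_mul_nonneg hs i j
  have hy := h.inner_sq_add_tripleProduct_sq i j
  have hz := h.inner_sq_add_tripleProduct_sq j i
  have hκ := h.inner_mul_one_sub_sq i j
  have hm := cos_mul_inner_le_of_mem_lune (h.right_mem i j)
  have hq := (h.left_mem j i).1
  simp only [inner_add_right, real_inner_smul_right] at hm
  rw [tripleProduct_swap, neg_sq, real_inner_comm (e i : E3) (e j)] at hz
  rw [real_inner_comm (k j : E3) (e i)] at hm
  have hL1 := inner_coe_le_one (e i) (e j)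
  set L := ⟪(e i : E3), e j⟫_ℝ
  set p := ⟪(k i : E3), e j⟫_ℝ
  set q := ⟪(k j : E3), e i⟫_ℝ
  set y := tripleProduct (e i) (e j) (k i)
  set z := tripleProduct (e i) (e j) (k j)
  rcases hL1.eq_or_lt with hL1 | hL1
  · exact hL1 ▸ cos_sq_le_one δ
  have hyz' : y ^ 2 ≤ y * z := by
    have hyz_abs : |y| ≤ |z| := sq_le_sq.1 (by nlinarith)
    rw [← abs_of_nonneg hyz, abs_mul, ← sq_abs, sq]
    exact mul_le_mul_of_nonneg_left hyz_abs (abs_nonneg y)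
  have hℓ : 0 < 1 - L ^ 2 := by nlinarith
  have hfactor : 0 ≤ (1 + L) * ((cos δ * p + sin δ * (1 - L)) * (sin δ * p - cos δ * (1 - L))) := by
    have hqℓ : 0 ≤ sin δ ^ 2 * (1 - L ^ 2) * (p - q) :=
      mul_nonneg (by positivity) (sub_nonneg.2 hqp)
    have hqp' : 0 ≤ sin δ * cos δ * L * p * (p - q) :=
      mul_nonneg (by positivity) (sub_nonneg.2 hqp)
    have hyz'' := mul_le_mul_of_nonneg_left hyz' (mul_nonneg hs.le hc)
    linear_combination mul_nonneg (sub_nonneg.2 hm) hℓ.le + hqℓ + hqp' + hyz'' -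
      sin δ * cos δ * hκ - sin δ * cos δ * hy
  have hsp : 0 ≤ sin δ * p - cos δ * (1 - L) := by
    have hpos : 0 < cos δ * p + sin δ * (1 - L) :=
      add_pos_of_nonneg_of_pos (mul_nonneg hc hp) (mul_pos hs (sub_pos.2 hL1))
    exact nonneg_of_mul_nonneg_right (nonneg_of_mul_nonneg_right hfactor (by linarith)) hpos
  linear_combination cos δ * hsp + sin δ * hcp + L * sin_sq_add_cos_sq δ

end LinkedLunes

/-- By `ha` and `hb` the half great circle from `e₃` through `k` meets the side joining `e₁` and
`e₂`. -/
lemma tripleProduct_sq_le_of_inside {δ : ℝ} {e₁ e₂ e₃ k : S2} (hc : 0 ≤ cos δ)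
    (hke : ⟪(k : E3), e₃⟫_ℝ = 0) (h₁ : (e₁ : E3) ∈ lune δ e₃ k) (h₂ : (e₂ : E3) ∈ lune δ e₃ k)
    (ha : 0 ≤ tripleProduct e₁ e₂ e₃ * tripleProduct e₂ e₃ k)
    (hb : 0 ≤ tripleProduct e₁ e₂ e₃ * tripleProduct e₃ e₁ k) :
    tripleProduct e₁ e₂ e₃ ^ 2 ≤ sin δ ^ 2 * (1 - ⟪(e₁ : E3), e₂⟫_ℝ ^ 2) := by
  have hsum := tripleProduct_sq_add_sq_le e₁ e₂ hke
  have hcramer := tripleProduct_mul_inner e₁ e₂ e₃ k (sin δ • (e₃ : E3) - cos δ • (k : E3))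
  have hm₁ := h₁.2
  have hm₂ := h₂.2
  rw [real_inner_comm] at hm₁ hm₂
  have h₃ : ⟪(e₃ : E3), sin δ • (e₃ : E3) - cos δ • (k : E3)⟫_ℝ = sin δ := by
    rw [inner_sub_right, real_inner_smul_right, real_inner_smul_right, inner_coe_self,
      real_inner_comm, hke]
    ring
  have hk : ⟪(k : E3), sin δ • (e₃ : E3) - cos δ • (k : E3)⟫_ℝ = -cos δ := by
    rw [inner_sub_right, real_inner_smul_right, real_inner_smul_right, inner_coe_self, hke]
    ring
  rw [hk, h₃] at hcramer
  set m := sin δ • (e₃ : E3) - cos δ • (k : E3)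
  set V := tripleProduct e₁ e₂ e₃
  set W := tripleProduct e₁ e₂ k
  have hVW : (cos δ * V) ^ 2 ≤ -(sin δ * W) * (cos δ * V) := by
    have := mul_nonneg hc (add_nonneg (mul_nonneg ha hm₁) (mul_nonneg hb hm₂))
    linear_combination this - cos δ * V * hcramer
  have hcV := sq_le_sq_of_sq_le_mul hVW
  have hsV := mul_le_mul_of_nonneg_left hsum (sq_nonneg (sin δ))
  linear_combination hcV + hsV - V ^ 2 * sin_sq_add_cos_sq δ

lemma tripleProduct_sq_le_of_outside {e₁ e₂ e₃ k : S2} (hke : ⟪(k : E3), e₂⟫_ℝ = 0)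
    (h₁ : 0 ≤ ⟪(k : E3), e₁⟫_ℝ) (ha : tripleProduct e₁ e₂ e₃ * tripleProduct e₂ e₃ k ≤ 0) :
    tripleProduct e₁ e₂ e₃ ^ 2 ≤ ⟪(k : E3), e₃⟫_ℝ ^ 2 * (1 - ⟪(e₁ : E3), e₂⟫_ℝ ^ 2) := by
  have hcramer := tripleProduct_mul_inner e₁ e₂ e₃ k k
  rw [inner_coe_self, mul_one, real_inner_comm (k : E3) e₂, hke, real_inner_comm (k : E3) e₁,
    real_inner_comm (k : E3) e₃] at hcramer
  have hsum := tripleProduct_sq_add_sq_le e₁ e₂ hke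
  have hle : tripleProduct e₁ e₂ e₃ ^ 2 ≤
      ⟪(k : E3), e₃⟫_ℝ * tripleProduct e₁ e₂ k * tripleProduct e₁ e₂ e₃ := by
    linear_combination mul_nonpos_of_nonneg_of_nonpos h₁ ha + tripleProduct e₁ e₂ e₃ * hcramer
  calc tripleProduct e₁ e₂ e₃ ^ 2
      ≤ ⟪(k : E3), e₃⟫_ℝ ^ 2 * tripleProduct e₁ e₂ k ^ 2 := by
        rw [← mul_pow]
        exact sq_le_sq_of_sq_le_mul hle
    _ ≤ ⟪(k : E3), e₃⟫_ℝ ^ 2 * (1 - ⟪(e₁ : E3), e₂⟫_ℝ ^ 2) :=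
        mul_le_mul_of_nonneg_left (by linarith [sq_nonneg (tripleProduct e₁ e₂ e₂)])
          (sq_nonneg _)

namespace LinkedLunes

variable {ι : Type*} {δ : ℝ} {e k : ι → S2}

lemma tripleProduct_sq_le_of_neg (h : LinkedLunes δ e k) (hs : 0 < sin δ) (hc : 0 ≤ cos δ)
    {i j l : ι} (hneg : tripleProduct (e i) (e j) (e l) * tripleProduct (e j) (e l) (k l) < 0) :
    tripleProduct (e i) (e j) (e l) ^ 2 ≤ sin δ ^ 2 * (1 - ⟪(e i : E3), e j⟫_ℝ ^ 2) := by
  have hcross := h.tripleProduct_mul_nonneg hs j l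
  have hout : tripleProduct (e i) (e j) (e l) * tripleProduct (e j) (e l) (k j) ≤ 0 := by
    by_contra! hpos
    nlinarith [mul_neg_of_pos_of_neg hpos hneg,
      mul_nonneg (sq_nonneg (tripleProduct (e i) (e j) (e l))) hcross]
  refine (tripleProduct_sq_le_of_outside (h.orth j) (h.left_mem j i).1 hout).trans ?_
  refine mul_le_mul_of_nonneg_right
    (inner_sq_le_sin_sq_of_mem_lune hc (h.orth j) (h.left_mem j l)) ?_
  linarith [tripleProduct_sq_add_sq_le (e i) (e j) (h.orth l),
    sq_nonneg (tripleProduct (e i) (e j) (k l)), sq_nonneg (tripleProduct (e i) (e j) (e l))]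

/-- The triple product of a triangle is the product of the sines of a side and of the height on it,
so this bounds the heights by `δ`. -/
lemma tripleProduct_sq_le (h : LinkedLunes δ e k) (hs : 0 < sin δ) (hc : 0 ≤ cos δ) (i j l : ι) :
    tripleProduct (e i) (e j) (e l) ^ 2 ≤ sin δ ^ 2 * (1 - ⟪(e i : E3), e j⟫_ℝ ^ 2) := by
  rcases lt_or_ge (tripleProduct (e i) (e j) (e l) * tripleProduct (e j) (e l) (k l)) 0 with ha | ha
  · exact h.tripleProduct_sq_le_of_neg hs hc ha
  rcases lt_or_ge (tripleProduct (e i) (e j) (e l) * tripleProduct (e l) (e i) (k l)) 0 with hb | hb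
  · have hswap : tripleProduct (e j) (e i) (e l) * tripleProduct (e i) (e l) (k l) < 0 := by
      rwa [tripleProduct_swap, tripleProduct_swap (e l : E3) (e i), neg_mul_neg]
    have := h.tripleProduct_sq_le_of_neg hs hc hswap
    rwa [tripleProduct_swap, neg_sq, real_inner_comm] at this
  exact tripleProduct_sq_le_of_inside hc (h.orth l) (h.left_mem l i) (h.left_mem l j) ha hb

end LinkedLunes

/-! ### The circumradius of a triangle -/

/-- The quadratic form `‖x • u + y • v + z • w‖ ^ 2` of unit vectors `u`, `v`, `w` with inner
products `a = ⟪v, w⟫`, `b = ⟪u, w⟫`, `c = ⟪u, v⟫`. -/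
def gramForm (a b c x y z : ℝ) : ℝ :=
  x ^ 2 + y ^ 2 + z ^ 2 + 2 * (a * (y * z) + b * (x * z) + c * (x * y))

lemma norm_sq_eq_gramForm (u v w : S2) (x y z : ℝ) :
    ‖x • (u : E3) + y • (v : E3) + z • (w : E3)‖ ^ 2 =
      gramForm ⟪(v : E3), w⟫_ℝ ⟪(u : E3), w⟫_ℝ ⟪(u : E3), v⟫_ℝ x y z := by
  rw [← real_inner_self_eq_norm_sq]
  simp only [gramForm, inner_add_left, inner_add_right, real_inner_smul_left,
    real_inner_smul_right, inner_coe_self, real_inner_comm (u : E3) v, real_inner_comm (u : E3) w,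
    real_inner_comm (v : E3) w]
  ring

section GramForm

variable {C a b c a' b' c' x y z : ℝ}

lemma gramForm_mono (hx : 0 ≤ x) (hy : 0 ≤ y) (hz : 0 ≤ z) (ha : a ≤ a') (hb : b ≤ b')
    (hc : c ≤ c') : gramForm a b c x y z ≤ gramForm a' b' c' x y z := by
  unfold gramForm
  gcongr

lemma le_gramForm_self_self_sq (h₀ : 0 ≤ C) (h₁ : C ≤ 1) (x y z : ℝ) :
    (1 + C) * (x + y + z) ^ 2 ≤ (3 - C) * gramForm C C (C ^ 2) x y z := by
  have h : 0 ≤ (1 - C) * (2 * (z - (1 - C) / 2 * (x + y)) ^ 2 +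
      (1 + C) * (3 - C) / 2 * (x - y) ^ 2) :=
    mul_nonneg (by linarith) (add_nonneg (by positivity) (mul_nonneg
      (div_nonneg (mul_nonneg (by linarith) (by linarith)) (by norm_num)) (sq_nonneg _)))
  unfold gramForm
  linear_combination h

lemma le_gramForm_one_sq_sq (h₁ : C ≤ 1) (hx : 0 ≤ x) (hy : 0 ≤ y) (hz : 0 ≤ z) :
    (1 + C) * (x + y + z) ^ 2 ≤ (3 - C) * gramForm 1 (C ^ 2) (C ^ 2) x y z := by
  have h : 0 ≤ (1 - C) * (2 * (x - (y + z)) ^ 2 + 2 * (1 - C) ^ 2 * (x * (y + z))) :=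
    mul_nonneg (by linarith) (by positivity)
  unfold gramForm
  linear_combination h

lemma le_gramForm_of_mem_Icc (h₀ : 0 ≤ C) (h₁ : C < 1) (ha : a ∈ Icc C 1) (hx : 0 ≤ x)
    (hy : 0 ≤ y) (hz : 0 ≤ z) :
    (1 + C) * (x + y + z) ^ 2 ≤ (3 - C) * gramForm a (C * (1 + C - a)) (C ^ 2) x y z := by
  have hright := mul_le_mul_of_nonneg_left (le_gramForm_self_self_sq h₀ h₁.le x y z)
    (sub_nonneg.2 ha.2)
  have hsegment := mul_le_mul_of_nonneg_left (le_gramForm_one_sq_sq h₁.le hx hy hz)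
    (sub_nonneg.2 ha.1)
  refine le_of_mul_le_mul_left ?_ (sub_pos.2 h₁)
  unfold gramForm at *
  linear_combination hright + hsegment

lemma le_gramForm_isosceles (h₁ : C < 1) (hc : c ≤ 1)
    (h : 2 * (C - b) * (1 - b) ≤ (1 - C) * (c - b ^ 2)) (x y z : ℝ) :
    (1 + C) * (x + y + z) ^ 2 ≤ (3 - C) * gramForm b b c x y z := by
  have hsq : 0 ≤ (2 * (1 - C) * z - ((1 + C) - (3 - C) * b) * (x + y)) ^ 2 := sq_nonneg _
  have hadd : 0 ≤ (3 - C) * ((1 - C) * (c - b ^ 2) - 2 * (C - b) * (1 - b)) * (x + y) ^ 2 :=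
    mul_nonneg (mul_nonneg (by linarith) (sub_nonneg.2 h)) (sq_nonneg _)
  have hsub : 0 ≤ (1 - C) * ((3 - C) * (1 - c)) * (x - y) ^ 2 :=
    mul_nonneg (mul_nonneg (by linarith) (mul_nonneg (by linarith) (by linarith))) (sq_nonneg _)
  refine le_of_mul_le_mul_left (a := 2 * (1 - C)) ?_ (by linarith)
  unfold gramForm
  linear_combination hsq + hadd + hsub

lemma mul_sub_le_of_sq_mul_le (hb₀ : 0 < b) (hbC : b ≤ C) (hC₁ : C < 1)
    (h : C ^ 2 * (1 + b) ≤ 2 * b ^ 2) :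
    4 * (C - b) * (1 - b) ≤ (1 - C) ^ 2 * (C + b) * (1 + b) := by
  set t := √((1 + b) / 2)
  have ht : t ^ 2 = (1 + b) / 2 := sq_sqrt (by linarith)
  have htpos : 0 < t := sqrt_pos.2 (by linarith)
  have hthalf : 1 / 2 ≤ t := by nlinarith
  have ht1 : t ≤ 1 := by nlinarith
  have hCt : C * t ≤ b := le_of_sq_le_sq (by rw [mul_pow, ht]; linarith) hb₀.le
  have hleft : 4 * (C - b) * (1 - b) ≤ 8 * (C + b) * (1 - t) ^ 2 := by
    have : (C - b) * (1 + t) ≤ (C + b) * (1 - t) := by linarith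
    linear_combination 8 * mul_le_mul_of_nonneg_left this (sub_nonneg.2 ht1) + 8 * (C - b) * ht
  have hright : 2 * (1 - t) ≤ t * (1 - C) := by
    have : 0 ≤ (1 - t) * (2 * t - 1) := mul_nonneg (by linarith) (by linarith)
    linear_combination this + hCt - 2 * ht
  have hsq := pow_le_pow_left₀ (by linarith) hright 2
  linear_combination hleft + 2 * mul_le_mul_of_nonneg_left hsq (by linarith : 0 ≤ C + b) +
    2 * (C + b) * (1 - C) ^ 2 * ht

lemma mul_sub_le_sqrt_mul_sqrt (hb₀ : 0 < b) (hbC : b ≤ C) (hC₁ : C < 1)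
    (h : C ^ 2 * (1 + b) ≤ 2 * b ^ 2) :
    2 * (C - b) * (1 - b) ≤ (1 - C) * (√(C ^ 2 - b ^ 2) * √(1 - b ^ 2)) := by
  have hmul : 0 ≤ (C - b) * (1 - b) := mul_nonneg (by linarith) (by linarith)
  refine le_of_sq_le_sq ?_ (mul_nonneg (by linarith) (by positivity))
  rw [mul_pow (1 - C), mul_pow √_, sq_sqrt (by nlinarith), sq_sqrt (by nlinarith)]
  linear_combination mul_le_mul_of_nonneg_left (mul_sub_le_of_sq_mul_le hb₀ hbC hC₁ h) hmul

lemma one_add_le_add_of_obtuse {B : ℝ} (hC : 0 < C) (hB₀ : 0 < B) (hB₁ : B < 1) (ha₀ : 0 ≤ a)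
    (ha₁ : a ≤ 1) (hcC : C ^ 2 ≤ c) (hobtuse : c ≤ a * (C * B))
    (h : (1 - a ^ 2) * (C ^ 2 - (C * B) ^ 2) ≤ (c - a * (C * B)) ^ 2) : 1 + C ≤ a + B := by
  have hnonneg : 0 ≤ a * B - C := by
    refine nonneg_of_mul_nonneg_right (a := C) ?_ hC
    linear_combination hcC + hobtuse
  have hle : (1 - a ^ 2) * (1 - B ^ 2) ≤ (a * B - C) ^ 2 := by
    refine le_of_mul_le_mul_left (a := C ^ 2) ?_ (by positivity)
    have : (a * (C * B) - c) ^ 2 ≤ (C * (a * B - C)) ^ 2 :=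
      pow_le_pow_left₀ (by linarith) (by linarith) 2
    linear_combination h + this
  have hmul : 0 ≤ (1 - a) * (1 - B) := mul_nonneg (by linarith) (by linarith)
  have hsq : ((1 - a) * (1 - B)) ^ 2 ≤ (a * B - C) ^ 2 := by
    refine le_trans ?_ hle
    linear_combination mul_le_mul_of_nonneg_left (by linarith : 0 ≤ 2 * (a + B)) hmul
  linarith [le_of_sq_le_sq hsq hnonneg]

lemma sq_mul_one_add_le_of_acute (hcb : c ≤ b) (ha₁ : a ≤ 1) (hacute : a * b < c)
    (h : (1 - a ^ 2) * (C ^ 2 - b ^ 2) ≤ (c - a * b) ^ 2) : C ^ 2 * (1 + a) ≤ 2 * b ^ 2 := by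
  have ha : a < 1 := ha₁.lt_of_ne (by rintro rfl; linarith)
  have hsq : (c - a * b) ^ 2 ≤ (b - a * b) ^ 2 := pow_le_pow_left₀ (by linarith) (by linarith) 2
  refine le_of_mul_le_mul_left ?_ (sub_pos.2 ha)
  linear_combination h + hsq

lemma sq_add_sqrt_mul_sqrt_le_of_acute (hb₀ : 0 < b) (hbC : b < C) (hC₁ : C < 1) (hba : b ≤ a)
    (ha₁ : a ≤ 1) (hacute : a * b < c) (hCab : C ^ 2 * (1 + a) ≤ 2 * b ^ 2)
    (h : (1 - a ^ 2) * (C ^ 2 - b ^ 2) ≤ (c - a * b) ^ 2) :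
    b ^ 2 + √(C ^ 2 - b ^ 2) * √(1 - b ^ 2) ≤ c := by
  set X := √(C ^ 2 - b ^ 2)
  set Y := √(1 - a ^ 2)
  set Z := √(1 - b ^ 2)
  have hX : X ^ 2 = C ^ 2 - b ^ 2 := sq_sqrt (by nlinarith)
  have hY : Y ^ 2 = 1 - a ^ 2 := sq_sqrt (by nlinarith)
  have hZ : Z ^ 2 = 1 - b ^ 2 := sq_sqrt (by nlinarith)
  have hX₀ : 0 ≤ X := sqrt_nonneg _
  have hY₀ : 0 ≤ Y := sqrt_nonneg _
  have hZ₀ : 0 < Z := sqrt_pos.2 (by nlinarith)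
  have hXY : X * Y ≤ c - a * b := by
    refine le_of_sq_le_sq ?_ (by linarith)
    rw [mul_pow, hX, hY]
    linarith
  have hXb : X * (1 + a) ≤ b * Y := by
    refine le_of_sq_le_sq ?_ (mul_nonneg hb₀.le hY₀)
    rw [mul_pow, mul_pow, hX, hY]
    linear_combination mul_le_mul_of_nonneg_left hCab (by linarith : 0 ≤ 1 + a)
  have hXZ : X * (Z - Y) ≤ b * (a - b) := by
    refine le_of_mul_le_mul_left (a := Z + Y) ?_ (by linarith)
    have : X * (a + b) ≤ b * (Z + Y) := by nlinarith
    linear_combination (a - b) * this + X * hZ - X * hY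
  linarith

/-- Here `a`, `b`, `c` are the cosines of the sides of a triangle, and `hheight` bounds its height
on the shortest side. Monotonicity in the cosines reduces the claim to right triangles with two
equal legs, degenerate triangles, interpolations of these, and isosceles triangles. -/
lemma le_gramForm (hC₀ : 0 ≤ C) (hC₁ : C < 1) (hcC : C ^ 2 ≤ c) (hcb : c ≤ b) (hba : b ≤ a)
    (ha₁ : a ≤ 1) (hheight : 1 + 2 * a * b * c - a ^ 2 - b ^ 2 - c ^ 2 ≤ (1 - C ^ 2) * (1 - a ^ 2))
    (hx : 0 ≤ x) (hy : 0 ≤ y) (hz : 0 ≤ z) :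
    (1 + C) * (x + y + z) ^ 2 ≤ (3 - C) * gramForm a b c x y z := by
  have of_le {a' b' c' : ℝ} (ha : a' ≤ a) (hb : b' ≤ b) (hc : c' ≤ c)
      (h : (1 + C) * (x + y + z) ^ 2 ≤ (3 - C) * gramForm a' b' c' x y z) :
      (1 + C) * (x + y + z) ^ 2 ≤ (3 - C) * gramForm a b c x y z :=
    h.trans (mul_le_mul_of_nonneg_left (gramForm_mono hx hy hz ha hb hc) (by linarith))
  rcases le_or_gt C b with hCb | hbC
  · exact of_le (hCb.trans hba) hCb hcC (le_gramForm_self_self_sq hC₀ hC₁.le x y z)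
  have hCpos : 0 < C := hC₀.lt_of_ne (by rintro rfl; nlinarith)
  have hb₀ : 0 < b := by nlinarith [pow_pos hCpos 2]
  have h : (1 - a ^ 2) * (C ^ 2 - b ^ 2) ≤ (c - a * b) ^ 2 := by linear_combination hheight
  rcases le_or_gt c (a * b) with hobtuse | hacute
  · obtain ⟨B, rfl⟩ : ∃ B, b = C * B := ⟨b / C, by field_simp⟩
    have hB₀ : 0 < B := pos_of_mul_pos_right hb₀ hC₀
    have hB₁ : B < 1 := by nlinarith
    have hsum := one_add_le_add_of_obtuse hCpos hB₀ hB₁ (by linarith) ha₁ hcC hobtuse h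
    exact of_le le_rfl (mul_le_mul_of_nonneg_left (by linarith) hC₀) hcC
      (le_gramForm_of_mem_Icc hC₀ hC₁ ⟨by linarith, ha₁⟩ hx hy hz)
  · have hCab := sq_mul_one_add_le_of_acute hcb ha₁ hacute h
    have hCb : C ^ 2 * (1 + b) ≤ 2 * b ^ 2 :=
      (mul_le_mul_of_nonneg_left (by linarith) (sq_nonneg C)).trans hCab
    have hroot := sq_add_sqrt_mul_sqrt_le_of_acute hb₀ hbC hC₁ hba ha₁ hacute hCab h
    refine of_le hba le_rfl le_rfl (le_gramForm_isosceles hC₁ (by linarith) ?_ x y z)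
    exact (mul_sub_le_sqrt_mul_sqrt hb₀ hbC.le hC₁ hCb).trans
      (mul_le_mul_of_nonneg_left (by linarith) (by linarith))

end GramForm

namespace LinkedLunes

variable {ι : Type*} {δ : ℝ} {e k : ι → S2} {x y z : ℝ}

lemma le_norm_sq_of_le (h : LinkedLunes δ e k) (hs : 0 < sin δ) (hc : 0 ≤ cos δ) {i j l : ι}
    (hx : 0 ≤ x) (hy : 0 ≤ y) (hz : 0 ≤ z) (hij : ⟪(e i : E3), e j⟫_ℝ ≤ ⟪(e i : E3), e l⟫_ℝ)
    (hil : ⟪(e i : E3), e l⟫_ℝ ≤ ⟪(e j : E3), e l⟫_ℝ) :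
    (1 + cos δ) * (x + y + z) ^ 2 ≤
      (3 - cos δ) * ‖x • (e i : E3) + y • (e j : E3) + z • (e l : E3)‖ ^ 2 := by
  have hcs := sin_sq_add_cos_sq δ
  rw [norm_sq_eq_gramForm]
  refine le_gramForm hc (by nlinarith) (h.cos_sq_le_inner hs hc i j) hij hil
    (inner_coe_le_one _ _) ?_ hx hy hz
  have hvol := h.tripleProduct_sq_le hs hc j l i
  have hgram := tripleProduct_mul_tripleProduct (e j) (e l) (e i) (e j) (e l) (e i)
  rw [inner_coe_self, inner_coe_self, inner_coe_self, real_inner_comm (e i : E3) (e j),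
    real_inner_comm (e i : E3) (e l), real_inner_comm (e j : E3) (e l)] at hgram
  rw [← eq_sub_iff_add_eq.2 hcs]
  linear_combination hvol - hgram

lemma le_norm_sq (h : LinkedLunes δ e k) (hs : 0 < sin δ) (hc : 0 ≤ cos δ) (i j l : ι)
    (hx : 0 ≤ x) (hy : 0 ≤ y) (hz : 0 ≤ z) :
    (1 + cos δ) * (x + y + z) ^ 2 ≤
      (3 - cos δ) * ‖x • (e i : E3) + y • (e j : E3) + z • (e l : E3)‖ ^ 2 := by
  wlog hij : ⟪(e i : E3), e j⟫_ℝ ≤ ⟪(e i : E3), e l⟫_ℝ generalizing j l y z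
  · simpa only [add_right_comm] using this l j hz hy (le_of_not_ge hij)
  rcases le_total ⟪(e i : E3), e l⟫_ℝ ⟪(e j : E3), e l⟫_ℝ with hil | hil
  · exact h.le_norm_sq_of_le hs hc hx hy hz hij hil
  rcases le_total ⟪(e i : E3), e j⟫_ℝ ⟪(e j : E3), e l⟫_ℝ with hjl | hjl
  · rw [real_inner_comm] at hjl
    simpa only [add_comm x y, add_comm (x • _) (y • _)] using
      h.le_norm_sq_of_le hs hc hy hx hz hjl hil
  · rw [real_inner_comm (e j : E3) (e i)] at hij hjl
    rw [real_inner_comm (e l : E3) (e i)] at hij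
    rw [add_assoc, add_comm x, add_assoc (x • _), add_comm (x • _)]
    exact h.le_norm_sq_of_le hs hc hy hz hx hjl hij

end LinkedLunes

/-! ### The covering disk of a reduced body -/

lemma mem_disk_iff {c p : S2} {ρ : ℝ} (h0 : 0 ≤ ρ) (hπ : ρ ≤ π) :
    p ∈ disk c ρ ↔ cos ρ ≤ ⟪(c : E3), p⟫_ℝ := by
  have hmem : sdist c p ∈ Icc 0 π :=
    ⟨InnerProductGeometry.angle_nonneg _ _, InnerProductGeometry.angle_le_pi _ _⟩
  rw [← cos_sdist, strictAntiOn_cos.le_iff_ge ⟨h0, hπ⟩ hmem]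
  rfl

lemma cos_sq_arctan_sqrt_two_mul_tan_half {δ : ℝ} (h : cos (δ / 2) ≠ 0) :
    cos (arctan (√2 * tan (δ / 2))) ^ 2 = (1 + cos δ) / (3 - cos δ) := by
  have hcos : cos δ = 2 * cos (δ / 2) ^ 2 - 1 := by
    rw [← cos_two_mul, mul_div_cancel₀ δ two_ne_zero]
  have hpos : 0 < 2 - cos (δ / 2) ^ 2 := by linarith [cos_sq_le_one (δ / 2)]
  have htan : 1 + 2 * ((1 - cos (δ / 2) ^ 2) / cos (δ / 2) ^ 2) =
      (2 - cos (δ / 2) ^ 2) / cos (δ / 2) ^ 2 := by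
    field_simp
    ring
  rw [cos_sq_arctan, mul_pow, sq_sqrt two_pos.le, tan_eq_sin_div_cos, div_pow, sin_sq, htan,
    one_div_div, hcos, div_eq_div_iff hpos.ne' (by linarith)]
  ring

lemma IsConvexBody.exists_circumcenter {R : Set S2} (hR : IsConvexBody R) :
    ∃ x : E3, x ≠ 0 ∧ (∀ r ∈ R, ‖x‖ ^ 2 ≤ ⟪x, (r : E3)⟫_ℝ) ∧ ∃ e : Fin 3 → S2,
      (∀ i, e i ∈ R ∧ ⟪x, (e i : E3)⟫_ℝ = ‖x‖ ^ 2) ∧ ∃ w ∈ stdSimplex ℝ (Fin 3),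
        ∑ i, w i • (e i : E3) = x := by
  set s : Set E3 := (fun p : S2 => (p : E3)) '' R
  have hne : (convexHull ℝ s).Nonempty := ((hR.2.2.mono interior_subset).image _).convexHull
  have hcomp : IsCompact (convexHull ℝ s) :=
    isCompact_convexHull (hR.1.isCompact.image continuous_subtype_val)
  obtain ⟨x, hx, hmin⟩ :=
    exists_forall_norm_sq_le_inner hne hcomp.isComplete (convex_convexHull ℝ s)
  have hsx : ∀ y ∈ s, ‖x‖ ^ 2 ≤ innerₛₗ ℝ x y := fun y hy => hmin y (subset_convexHull ℝ s hy)
  have hx0 : x ≠ 0 := by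
    rintro rfl
    obtain ⟨y, hy⟩ := hR.exists_forall_inner_pos
    have hsub : s ⊆ {z | 0 < innerₛₗ ℝ (y : E3) z} := by
      rintro _ ⟨p, hp, rfl⟩
      exact hy p hp
    simpa using convexHull_min hsub (convex_halfSpace_gt (innerₛₗ ℝ (y : E3)).isLinear 0) hx
  have hface := mem_convexHull_face hsx hx (real_inner_self_eq_norm_sq x)
  obtain ⟨z, hz, w, hw, hwx⟩ := exists_fin_sum_smul_eq_of_mem_convexHull
    finrank_euclideanSpace_fin.le (pow_ne_zero 2 (norm_ne_zero_iff.2 hx0)) (fun y hy => hy.2) hface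
  choose e heR hez using fun i => (hz i).1
  refine ⟨x, hx0, fun r hr => hsx r ⟨r, hr, rfl⟩, e, fun i => ⟨heR i, ?_⟩, w, hw, ?_⟩
  · rw [show (e i : E3) = z i from hez i]
    exact (hz i).2
  · rw [← hwx]
    exact Finset.sum_congr rfl fun i _ => congrArg (w i • ·) (hez i)

lemma IsConvexBody.linkedLunes {R : Set S2} (hR : IsConvexBody R) {ι : Type*} {e k m : ι → S2}
    (hd : ∀ i, IsDiametral R (k i) (m i)) (he : ∀ i, (e i : E3) = semicircleCenter (k i) (m i)) :
    LinkedLunes (thickness R) e k := by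
  have hmem : ∀ i, ∀ r ∈ R, (r : E3) ∈ lune (thickness R) (e i) (k i) := by
    refine fun i r hr => ⟨(hd i).left_mem r hr, ?_⟩
    rw [he i, ← (hd i).coe_right_eq hR]
    exact (hd i).right_mem r hr
  refine ⟨fun i => ?_, fun i j => ?_, fun i j => ?_⟩
  · rw [he i]
    exact (semicircleCenter_spec _ _ ((hd i).ne hR) ((hd i).ne_neg hR)).2.1
  · obtain ⟨q, hq, hqe⟩ := (hd j).exists_mem_eq_semicircleCenter hR
    rw [he j, ← hqe]
    exact hmem i q hq
  · obtain ⟨b, hb, hbe⟩ := (hd j).exists_mem_eq_cos_smul_add_sin_smul hR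
    rw [he j, ← hbe]
    exact hmem i b hb

lemma IsReduced.exists_isDiametral_of_inner_eq_norm_sq {R : Set S2} (hR : IsReduced R) {x : E3}
    (hx0 : x ≠ 0) (hx1 : ‖x‖ < 1) (hx : ∀ r ∈ R, ‖x‖ ^ 2 ≤ ⟪x, (r : E3)⟫_ℝ) {e : S2} (he : e ∈ R)
    (hxe : ⟪x, (e : E3)⟫_ℝ = ‖x‖ ^ 2) :
    ∃ k m, IsDiametral R k m ∧ (e : E3) = semicircleCenter k m := by
  have hpos : 0 < ‖x‖ := norm_pos_iff.2 hx0
  refine hR.exists_isDiametral_of_exposed (x := x - ‖x‖ ^ 2 • (e : E3)) he (fun h => ?_) ?_ ?_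
  · have hnorm : ‖x‖ = ‖x‖ ^ 2 := by
      simpa [norm_smul] using congrArg norm (sub_eq_zero.1 h)
    nlinarith
  · rw [inner_sub_left, real_inner_smul_left, inner_coe_self, hxe, mul_one, sub_self]
  · intro r hr hre
    rw [inner_sub_left, real_inner_smul_left]
    linarith [hx r hr, mul_lt_of_lt_one_right (pow_pos hpos 2) (inner_coe_lt_one hre.symm)]

lemma IsReduced.exists_forall_norm_sq_le_inner {R : Set S2} (hR : IsReduced R)
    (hle : thickness R ≤ π / 2) :
    ∃ x : E3, x ≠ 0 ∧ (∀ r ∈ R, ‖x‖ ^ 2 ≤ ⟪x, (r : E3)⟫_ℝ) ∧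
      1 + cos (thickness R) ≤ (3 - cos (thickness R)) * ‖x‖ ^ 2 := by
  obtain ⟨x, hx0, hx, e, he, w, ⟨hw, hsum⟩, hwx⟩ := hR.1.exists_circumcenter
  refine ⟨x, hx0, hx, ?_⟩
  rcases le_or_gt 1 ‖x‖ with hx1 | hx1
  · nlinarith [cos_le_one (thickness R)]
  choose k m hd hek using fun i =>
    hR.exists_isDiametral_of_inner_eq_norm_sq hx0 hx1 hx (he i).1 (he i).2
  have hcos : 0 ≤ cos (thickness R) :=
    cos_nonneg_of_neg_pi_div_two_le_of_le (by linarith [hR.1.thickness_mem_Ioo.1, pi_pos]) hle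
  have := (hR.1.linkedLunes hd hek).le_norm_sq hR.1.sin_thickness_pos hcos 0 1 2
    (hw 0) (hw 1) (hw 2)
  rwa [← Fin.sum_univ_three, hsum, one_pow, mul_one,
    ← Fin.sum_univ_three (fun i => w i • (e i : E3)), hwx] at this

lemma IsReduced.exists_subset_disk {R : Set S2} (hR : IsReduced R) (hle : thickness R ≤ π / 2) :
    ∃ c : S2, R ⊆ disk c (arctan (√2 * tan (thickness R / 2))) := by
  obtain ⟨x, hx0, hx, hnorm⟩ := hR.exists_forall_norm_sq_le_inner hle
  have hpos : 0 < thickness R := hR.1.thickness_mem_Ioo.1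
  have hhalf : 0 < cos (thickness R / 2) := cos_pos_of_mem_Ioo ⟨by linarith, by linarith⟩
  have hcos : cos (arctan (√2 * tan (thickness R / 2))) ≤ ‖x‖ := by
    refine le_of_sq_le_sq ?_ (norm_nonneg x)
    rw [cos_sq_arctan_sqrt_two_mul_tan_half hhalf.ne',
      div_le_iff₀' (by linarith [cos_le_one (thickness R)])]
    exact hnorm
  have hnonneg : 0 ≤ arctan (√2 * tan (thickness R / 2)) := arctan_nonneg.2 <|
    mul_nonneg (sqrt_nonneg 2) (tan_nonneg_of_nonneg_of_le_pi_div_two (by linarith) (by linarith))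
  refine ⟨unitVec x hx0, fun r hr => (mem_disk_iff hnonneg ?_).2 (hcos.trans ?_)⟩
  · linarith [arctan_lt_pi_div_two (√2 * tan (thickness R / 2))]
  · rw [inner_unitVec, le_inv_mul_iff₀ (norm_pos_iff.2 hx0), ← sq]
    exact hx r hr

/-! ### Quarters of disks -/

/-- Three pairwise orthogonal points of the sphere. -/
structure IsFrame (o u v : S2) : Prop where
  left_mid : ⟪(o : E3), u⟫_ℝ = 0
  left_right : ⟪(o : E3), v⟫_ℝ = 0
  mid_right : ⟪(u : E3), v⟫_ℝ = 0

/-- The point at signed distance `t` from `o` on the oriented great circle that passes through `o`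
and then, a quarter turn later, through `d`. -/
noncomputable def greatCirclePoint {o d : S2} (h : ⟪(o : E3), d⟫_ℝ = 0) (t : ℝ) : S2 :=
  ⟨cos t • (o : E3) + sin t • (d : E3), by
    rw [mem_sphere_zero_iff_norm, ← sq_eq_sq₀ (norm_nonneg _) zero_le_one,
      norm_add_sq_real, real_inner_smul_left, real_inner_smul_right, h]
    simp [norm_smul]⟩

section Arc

variable {o d u v a b p : S2} {δ : ℝ}

lemma inner_greatCirclePoint (h : ⟪(o : E3), d⟫_ℝ = 0) (t : ℝ) (x : E3) :
    ⟪(greatCirclePoint h t : E3), x⟫_ℝ = cos t * ⟪(o : E3), x⟫_ℝ + sin t * ⟪(d : E3), x⟫_ℝ := by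
  rw [greatCirclePoint, inner_add_left, real_inner_smul_left, real_inner_smul_left]

lemma inner_greatCirclePoint_right (h : ⟪(o : E3), d⟫_ℝ = 0) (t : ℝ) (x : E3) :
    ⟪x, (greatCirclePoint h t : E3)⟫_ℝ = cos t * ⟪x, (o : E3)⟫_ℝ + sin t * ⟪x, (d : E3)⟫_ℝ := by
  rw [greatCirclePoint, inner_add_right, real_inner_smul_right, real_inner_smul_right]

lemma inner_greatCirclePoint_sub_pi_div_two (h : ⟪(o : E3), d⟫_ℝ = 0) (x : E3) :
    ⟪(greatCirclePoint h (δ - π / 2) : E3), x⟫_ℝ =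
      sin δ * ⟪(o : E3), x⟫_ℝ - cos δ * ⟪(d : E3), x⟫_ℝ := by
  rw [inner_greatCirclePoint, cos_sub_pi_div_two, sin_sub_pi_div_two, neg_mul, sub_eq_add_neg]

lemma inner_greatCirclePoint_sub_pi_div_two_self (h : ⟪(o : E3), d⟫_ℝ = 0) :
    ⟪(d : E3), (greatCirclePoint h (δ - π / 2) : E3)⟫_ℝ = -cos δ := by
  rw [real_inner_comm, inner_greatCirclePoint_sub_pi_div_two, h, inner_coe_self]
  ring

-- The hemisphere on the right is tangent to the disk with center `o` and radius `δ` at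
-- `greatCirclePoint h δ`.
lemma cos_mul_one_sub_inner_le (h : ⟪(o : E3), d⟫_ℝ = 0) (hp : cos δ ≤ ⟪(o : E3), p⟫_ℝ) :
    cos δ * (1 - ⟪(greatCirclePoint h δ : E3), p⟫_ℝ) ≤
      sin δ * ⟪(greatCirclePoint h (δ - π / 2) : E3), p⟫_ℝ := by
  rw [inner_greatCirclePoint, inner_greatCirclePoint_sub_pi_div_two]
  linear_combination hp - ⟪(o : E3), p⟫_ℝ * sin_sq_add_cos_sq δ

lemma inner_eq_of_coe_eq {s t : ℝ} (hd : (d : E3) = s • (u : E3) + t • (v : E3)) (x : E3) :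
    ⟪(d : E3), x⟫_ℝ = s * ⟪(u : E3), x⟫_ℝ + t * ⟪(v : E3), x⟫_ℝ := by
  rw [hd, inner_add_left, real_inner_smul_left, real_inner_smul_left]

lemma inner_nonneg_of_mem_arc (hd : d ∈ arc u v) {x : E3} (hu : 0 ≤ ⟪(u : E3), x⟫_ℝ)
    (hv : 0 ≤ ⟪(v : E3), x⟫_ℝ) : 0 ≤ ⟪(d : E3), x⟫_ℝ := by
  obtain ⟨s, t, hs, ht, hd⟩ := hd
  rw [inner_eq_of_coe_eq hd]
  positivity

lemma le_inner_of_mem_arc {c : ℝ} (hc : 0 ≤ c) {x : E3} (ha : c ≤ ⟪x, (a : E3)⟫_ℝ)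
    (hb : c ≤ ⟪x, (b : E3)⟫_ℝ) (hp : p ∈ arc a b) : c ≤ ⟪x, (p : E3)⟫_ℝ := by
  obtain ⟨s, t, hs, ht, hp⟩ := hp
  have hst : 1 ≤ s + t := by
    have := norm_add_le (s • (a : E3)) (t • (b : E3))
    rw [← hp] at this
    simpa [norm_smul, abs_of_nonneg hs, abs_of_nonneg ht] using this
  rw [hp, inner_add_right, real_inner_smul_right, real_inner_smul_right]
  calc c ≤ (s + t) * c := le_mul_of_one_le_left hc hst
    _ ≤ _ := by
      rw [add_mul]
      gcongr

end Arc

lemma cos_nonneg_of_mem_Ioc {δ : ℝ} (hδ : δ ∈ Ioc 0 (π / 2)) : 0 ≤ cos δ :=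
  cos_nonneg_of_mem_Icc ⟨by linarith [hδ.1, pi_pos], hδ.2⟩

lemma sin_pos_of_mem_Ioc {δ : ℝ} (hδ : δ ∈ Ioc 0 (π / 2)) : 0 < sin δ :=
  sin_pos_of_mem_Ioo ⟨hδ.1, by linarith [hδ.2, pi_pos]⟩

lemma mem_quarterDisk_iff {o u v p : S2} {δ : ℝ} (hδ : δ ∈ Ioc 0 (π / 2)) :
    p ∈ quarterDisk o u v δ ↔
      cos δ ≤ ⟪(o : E3), p⟫_ℝ ∧ 0 ≤ ⟪(u : E3), p⟫_ℝ ∧ 0 ≤ ⟪(v : E3), p⟫_ℝ := by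
  rw [quarterDisk, mem_inter_iff, mem_inter_iff, mem_hemisphere, mem_hemisphere, and_assoc,
    mem_disk_iff hδ.1.le (by linarith [hδ.2, pi_pos])]

lemma quarterDisk_pi_div_two_rotate (o u v : S2) :
    quarterDisk u v o (π / 2) = quarterDisk o u v (π / 2) := by
  change hemisphere u ∩ hemisphere v ∩ hemisphere o = hemisphere o ∩ hemisphere u ∩ hemisphere v
  rw [inter_comm, inter_assoc]

lemma IsConvexBody.mem_of_le_thickness {Z : Set S2} (hZ : IsConvexBody Z) {δ : ℝ} (h0 : 0 ≤ δ)
    (hle : δ ≤ thickness Z) {k m w : S2} (hk : ∀ p ∈ Z, p ≠ w → 0 < ⟪(k : E3), p⟫_ℝ)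
    (hm : m ∈ polar Z) (hkm : ⟪(k : E3), m⟫_ℝ = -cos δ) : w ∈ Z := by
  by_contra hw
  have hlt := hZ.neg_cos_thickness_lt_inner (fun p hp => hk p hp (ne_of_mem_of_not_mem hp hw)) hm
  have hcos := cos_le_cos_of_nonneg_of_le_pi h0 hZ.thickness_mem_Ioo.2.le hle
  linarith

lemma mul_add_mul_le_of_sq_add_sq_le {c p₁ p₂ q₁ q₂ n₁ n₂ l₁ l₂ : ℝ} (hc : 0 ≤ c)
    (hn : n₁ ^ 2 + n₂ ^ 2 ≤ c ^ 2 * (1 - (p₁ ^ 2 + p₂ ^ 2)))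
    (hl : l₁ ^ 2 + l₂ ^ 2 ≤ c ^ 2 * (1 - (q₁ ^ 2 + q₂ ^ 2))) :
    p₁ * l₁ + p₂ * l₂ + n₁ * q₁ + n₂ * q₂ ≤ c := by
  rcases hc.eq_or_lt with rfl | hc
  · have hn₁ : n₁ = 0 := by nlinarith
    have hn₂ : n₂ = 0 := by nlinarith
    have hl₁ : l₁ = 0 := by nlinarith
    have hl₂ : l₂ = 0 := by nlinarith
    simp [hn₁, hn₂, hl₁, hl₂]
  · refine le_of_mul_le_mul_left ?_ (mul_pos two_pos hc)
    linarith [sq_nonneg (c * p₁ - l₁), sq_nonneg (c * p₂ - l₂), sq_nonneg (c * q₁ - n₁),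
      sq_nonneg (c * q₂ - n₂)]

lemma sq_eq_posPart_sq_add_negPart_sq (t : ℝ) : t ^ 2 = t⁺ ^ 2 + t⁻ ^ 2 := by
  rcases le_total 0 t with ht | ht <;> simp [ht]

lemma mul_negPart_self (t : ℝ) : t * t⁻ = -t⁻ ^ 2 := by
  rcases le_total 0 t with ht | ht <;> simp [ht, sq]

namespace IsFrame

variable {o u v : S2} {δ : ℝ}

lemma of_sdist (h₁ : sdist o u = π / 2) (h₂ : sdist o v = π / 2) (h₃ : sdist u v = π / 2) :
    IsFrame o u v := by
  constructor <;> rw [← cos_sdist, ‹sdist _ _ = _›, cos_pi_div_two]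

lemma rotate (h : IsFrame o u v) : IsFrame u v o :=
  ⟨h.mid_right, real_inner_comm (u : E3) o ▸ h.left_mid, real_inner_comm (v : E3) o ▸ h.left_right⟩

lemma exists_orthonormalBasis (h : IsFrame o u v) :
    ∃ b : OrthonormalBasis (Fin 3) ℝ E3, b 0 = o ∧ b 1 = u ∧ b 2 = v := by
  have hon : Orthonormal ℝ ![(o : E3), u, v] := by
    rw [orthonormal_iff_ite]
    simp [Fin.forall_fin_succ, h.left_mid, h.left_right, h.mid_right, h.rotate.left_right,
      h.rotate.mid_right, h.rotate.rotate.left_right]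
  let b := basisOfOrthonormalOfCardEqFinrank hon (by simp)
  have hb : ⇑b = ![(o : E3), u, v] := coe_basisOfOrthonormalOfCardEqFinrank hon _
  refine ⟨b.toOrthonormalBasis (hb ▸ hon), ?_⟩
  simp [hb]

lemma eq_add_smul (h : IsFrame o u v) (x : E3) :
    x = ⟪(o : E3), x⟫_ℝ • (o : E3) + (⟪(u : E3), x⟫_ℝ • (u : E3) + ⟪(v : E3), x⟫_ℝ • (v : E3)) := by
  obtain ⟨b, h0, h1, h2⟩ := h.exists_orthonormalBasis
  rw [← h0, ← h1, ← h2, ← add_assoc]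
  exact (b.sum_repr' x).symm.trans (Fin.sum_univ_three _)

lemma inner_eq (h : IsFrame o u v) (x y : E3) :
    ⟪x, y⟫_ℝ = ⟪(o : E3), x⟫_ℝ * ⟪(o : E3), y⟫_ℝ + ⟪(u : E3), x⟫_ℝ * ⟪(u : E3), y⟫_ℝ +
      ⟪(v : E3), x⟫_ℝ * ⟪(v : E3), y⟫_ℝ := by
  conv_lhs => rw [h.eq_add_smul x]
  simp only [inner_add_left, real_inner_smul_left, add_assoc]

lemma sum_inner_sq (h : IsFrame o u v) (p : S2) :
    ⟪(o : E3), p⟫_ℝ ^ 2 + ⟪(u : E3), p⟫_ℝ ^ 2 + ⟪(v : E3), p⟫_ℝ ^ 2 = 1 := by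
  rw [sq, sq, sq, ← h.inner_eq, inner_coe_self]

lemma norm_smul_add_smul_add_smul_sq (h : IsFrame o u v) (z x y : ℝ) :
    ‖z • (o : E3) + x • (u : E3) + y • (v : E3)‖ ^ 2 = z ^ 2 + x ^ 2 + y ^ 2 := by
  rw [← real_inner_self_eq_norm_sq]
  simp only [inner_add_left, inner_add_right, real_inner_smul_left, real_inner_smul_right,
    inner_coe_self, h.left_mid, h.left_right, h.mid_right, h.rotate.left_right,
    h.rotate.mid_right, h.rotate.rotate.left_right]
  ring

lemma left_mem_quarterDisk (h : IsFrame o u v) (hδ : δ ∈ Ioc 0 (π / 2)) :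
    o ∈ quarterDisk o u v δ := by
  rw [mem_quarterDisk_iff hδ, inner_coe_self, h.rotate.left_right, h.rotate.mid_right]
  exact ⟨cos_le_one δ, le_rfl, le_rfl⟩

lemma inner_eq_zero_of_mem_arc (h : IsFrame o u v) {d : S2} (hd : d ∈ arc u v) :
    ⟪(o : E3), d⟫_ℝ = 0 := by
  obtain ⟨s, t, -, -, hd⟩ := hd
  rw [real_inner_comm, inner_eq_of_coe_eq hd, h.rotate.left_right, h.rotate.mid_right, mul_zero,
    mul_zero, add_zero]

lemma inner_nonneg_of_mem_arc (h : IsFrame o u v) {d : S2} (hd : d ∈ arc u v) :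
    0 ≤ ⟪(u : E3), d⟫_ℝ ∧ 0 ≤ ⟪(v : E3), d⟫_ℝ := by
  rw [real_inner_comm, real_inner_comm (d : E3) v]
  constructor <;> refine Spherical.inner_nonneg_of_mem_arc hd ?_ ?_ <;>
    simp [h.mid_right, h.rotate.rotate.left_right]

lemma exists_mem_arc_smul_eq (h : IsFrame o u v) {x y : ℝ} (hx : 0 ≤ x) (hy : 0 ≤ y) :
    ∃ r ≥ (0 : ℝ), ∃ d ∈ arc u v,
      x • (u : E3) + y • (v : E3) = r • (d : E3) ∧ r ^ 2 = x ^ 2 + y ^ 2 := by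
  set w : E3 := x • (u : E3) + y • (v : E3) with hw
  have hnorm : ‖w‖ ^ 2 = x ^ 2 + y ^ 2 := by
    simpa [hw] using h.norm_smul_add_smul_add_smul_sq 0 x y
  by_cases h0 : w = 0
  · refine ⟨0, le_rfl, u, ⟨1, 0, zero_le_one, le_rfl, by simp⟩, by rw [h0, zero_smul], ?_⟩
    rw [← hnorm, h0, norm_zero]
  · refine ⟨‖w‖, norm_nonneg w, unitVec w h0,
      ⟨‖w‖⁻¹ * x, ‖w‖⁻¹ * y, by positivity, by positivity, ?_⟩,
      (smul_inv_smul₀ (norm_ne_zero_iff.2 h0) w).symm, hnorm⟩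
    rw [mul_smul, mul_smul, ← smul_add]
    rfl

lemma greatCirclePoint_mem_quarterDisk (h : IsFrame o u v) (hδ : δ ∈ Ioc 0 (π / 2)) {d : S2}
    (hd : d ∈ arc u v) :
    greatCirclePoint (h.inner_eq_zero_of_mem_arc hd) δ ∈ quarterDisk o u v δ := by
  obtain ⟨hu, hv⟩ := h.inner_nonneg_of_mem_arc hd
  have hsin := (sin_pos_of_mem_Ioc hδ).le
  rw [mem_quarterDisk_iff hδ]
  simp only [inner_greatCirclePoint_right, inner_coe_self, h.inner_eq_zero_of_mem_arc hd,
    h.rotate.left_right, h.rotate.mid_right, mul_zero, mul_one, add_zero, zero_add]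
  exact ⟨le_rfl, mul_nonneg hsin hu, mul_nonneg hsin hv⟩

lemma mem_polar_quarterDisk (hδ : δ ∈ Ioc 0 (π / 2)) {d : S2} (hd : d ∈ arc u v) :
    d ∈ polar (quarterDisk o u v δ) := by
  intro p hp
  obtain ⟨-, hu, hv⟩ := (mem_quarterDisk_iff hδ).1 hp
  exact Spherical.inner_nonneg_of_mem_arc hd hu hv

lemma greatCirclePoint_mem_polar_quarterDisk (hδ : δ ∈ Ioc 0 (π / 2)) {d : S2}
    (hod : ⟪(o : E3), d⟫_ℝ = 0) :
    greatCirclePoint hod (δ - π / 2) ∈ polar (quarterDisk o u v δ) := by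
  intro p hp
  refine nonneg_of_mul_nonneg_right (le_trans ?_ (cos_mul_one_sub_inner_le hod
    ((mem_quarterDisk_iff hδ).1 hp).1)) (sin_pos_of_mem_Ioc hδ)
  exact mul_nonneg (cos_nonneg_of_mem_Ioc hδ) (sub_nonneg.2 (inner_coe_le_one _ _))

lemma exists_bisector (h : IsFrame o u v) :
    ∃ d ∈ arc u v, ∃ r > (0 : ℝ), (u : E3) + v = r • (d : E3) := by
  obtain ⟨r, hr, d, hd, heq, hsq⟩ := h.exists_mem_arc_smul_eq zero_le_one zero_le_one
  refine ⟨d, hd, r, hr.lt_of_ne' ?_, by simpa using heq⟩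
  rintro rfl
  norm_num at hsq

lemma exists_inner_pos (h : IsFrame o u v) (hδ : δ ∈ Ioc 0 (π / 2)) :
    ∃ p : S2, cos δ < ⟪(o : E3), p⟫_ℝ ∧ 0 < ⟪(u : E3), p⟫_ℝ ∧ 0 < ⟪(v : E3), p⟫_ℝ := by
  obtain ⟨d, hd, r, hr, hbis⟩ := h.exists_bisector
  have hinner (x : E3) : ⟪x, (u : E3)⟫_ℝ + ⟪x, (v : E3)⟫_ℝ = r * ⟪x, (d : E3)⟫_ℝ := by
    rw [← inner_add_right, hbis, real_inner_smul_right]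
  have hu : 0 < ⟪(u : E3), d⟫_ℝ := by
    refine pos_of_mul_pos_right ?_ hr.le
    rw [← hinner, inner_coe_self, h.mid_right]
    norm_num
  have hv : 0 < ⟪(v : E3), d⟫_ℝ := by
    refine pos_of_mul_pos_right ?_ hr.le
    rw [← hinner, inner_coe_self, h.rotate.rotate.left_right]
    norm_num
  have hsin : 0 < sin (δ / 2) := sin_pos_of_mem_Ioo ⟨half_pos hδ.1, by linarith [hδ.2, pi_pos]⟩
  refine ⟨greatCirclePoint (h.inner_eq_zero_of_mem_arc hd) (δ / 2), ?_⟩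
  simp only [inner_greatCirclePoint_right, inner_coe_self, h.inner_eq_zero_of_mem_arc hd,
    h.rotate.left_right, h.rotate.mid_right, mul_zero, mul_one, add_zero, zero_add]
  exact ⟨cos_lt_cos_of_nonneg_of_le_pi (half_pos hδ.1).le (by linarith [hδ.2, pi_pos])
    (half_lt_self hδ.1), mul_pos hsin hu, mul_pos hsin hv⟩

lemma isConvexBody_quarterDisk (h : IsFrame o u v) (hδ : δ ∈ Ioc 0 (π / 2)) :
    IsConvexBody (quarterDisk o u v δ) := by
  have hQ : quarterDisk o u v δ = {p : S2 | cos δ ≤ ⟪(o : E3), p⟫_ℝ ∧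
      0 ≤ ⟪(u : E3), p⟫_ℝ ∧ 0 ≤ ⟪(v : E3), p⟫_ℝ} := Set.ext fun p => mem_quarterDisk_iff hδ
  have hcos := cos_nonneg_of_mem_Ioc hδ
  rw [hQ]
  refine ⟨?_, ⟨?_, ?_⟩, ?_⟩
  · exact (isClosed_le continuous_const (by fun_prop)).and
      ((isClosed_le continuous_const (by fun_prop)).and
        (isClosed_le continuous_const (by fun_prop)))
  · rintro a ⟨ho, hu, hv⟩ ⟨ho', hu', hv'⟩
    rw [coe_neg_sphere, inner_neg_right] at ho' hu' hv'
    have hsum := h.sum_inner_sq a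
    rw [show ⟪(o : E3), a⟫_ℝ = 0 by linarith, show ⟪(u : E3), a⟫_ℝ = 0 by linarith,
      show ⟪(v : E3), a⟫_ℝ = 0 by linarith] at hsum
    norm_num at hsum
  · rintro a ⟨hoa, hua, hva⟩ b ⟨hob, hub, hvb⟩ p hp
    exact ⟨le_inner_of_mem_arc hcos hoa hob hp, le_inner_of_mem_arc le_rfl hua hub hp,
      le_inner_of_mem_arc le_rfl hva hvb hp⟩
  · obtain ⟨p, ho, hu, hv⟩ := h.exists_inner_pos hδ
    refine ⟨p, mem_interior.2 ⟨{p : S2 | cos δ < ⟪(o : E3), p⟫_ℝ ∧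
      0 < ⟪(u : E3), p⟫_ℝ ∧ 0 < ⟪(v : E3), p⟫_ℝ}, ?_, ?_, ho, hu, hv⟩⟩
    · exact fun q hq => ⟨hq.1.le, hq.2.1.le, hq.2.2.le⟩
    · exact (isOpen_lt continuous_const (by fun_prop)).and
        ((isOpen_lt continuous_const (by fun_prop)).and
          (isOpen_lt continuous_const (by fun_prop)))

lemma inner_nonneg_of_mem_polar (h : IsFrame o u v) (hδ : δ ∈ Ioc 0 (π / 2)) {k : S2}
    (hk : k ∈ polar (quarterDisk o u v δ)) : 0 ≤ ⟪(o : E3), k⟫_ℝ := by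
  rw [real_inner_comm]
  exact hk o (h.left_mem_quarterDisk hδ)

lemma sq_mul_negPart_sq_add_le_of_mem_polar (h : IsFrame o u v) (hδ : δ ∈ Ioc 0 (π / 2)) {k : S2}
    (hk : k ∈ polar (quarterDisk o u v δ)) :
    sin δ ^ 2 * ((⟪(u : E3), k⟫_ℝ)⁻ ^ 2 + (⟪(v : E3), k⟫_ℝ)⁻ ^ 2) ≤
      cos δ ^ 2 * ⟪(o : E3), k⟫_ℝ ^ 2 := by
  obtain ⟨r, hr, d, hd, hrd, hsq⟩ :=
    h.exists_mem_arc_smul_eq (negPart_nonneg ⟪(u : E3), k⟫_ℝ) (negPart_nonneg ⟪(v : E3), k⟫_ℝ)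
  have hdk : r * ⟪(d : E3), k⟫_ℝ = -r ^ 2 := by
    rw [← real_inner_smul_left, ← hrd, inner_add_left, real_inner_smul_left, real_inner_smul_left,
      mul_comm, mul_negPart_self, mul_comm _ ⟪(v : E3), k⟫_ℝ, mul_negPart_self, hsq, neg_add]
  have hsin := sin_pos_of_mem_Ioc hδ
  have hpoint := hk _ (h.greatCirclePoint_mem_quarterDisk hδ hd)
  rw [real_inner_comm, inner_greatCirclePoint] at hpoint
  have hle : (sin δ * r) ^ 2 ≤ cos δ * ⟪(o : E3), k⟫_ℝ * (sin δ * r) := by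
    linear_combination (sin δ * r) * hpoint + sin δ ^ 2 * hdk
  rw [← hsq, ← mul_pow, ← mul_pow]
  exact sq_le_sq_of_sq_le_mul hle

lemma negPart_sq_add_le_of_mem_polar (h : IsFrame o u v) (hδ : δ ∈ Ioc 0 (π / 2)) {k : S2}
    (hk : k ∈ polar (quarterDisk o u v δ)) :
    (⟪(u : E3), k⟫_ℝ)⁻ ^ 2 + (⟪(v : E3), k⟫_ℝ)⁻ ^ 2 ≤
      cos δ ^ 2 * (1 - ((⟪(u : E3), k⟫_ℝ)⁺ ^ 2 + (⟪(v : E3), k⟫_ℝ)⁺ ^ 2)) := by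
  have hsum := h.sum_inner_sq k
  rw [sq_eq_posPart_sq_add_negPart_sq ⟪(u : E3), k⟫_ℝ,
    sq_eq_posPart_sq_add_negPart_sq ⟪(v : E3), k⟫_ℝ] at hsum
  linear_combination h.sq_mul_negPart_sq_add_le_of_mem_polar hδ hk + cos δ ^ 2 * hsum -
    ((⟪(u : E3), k⟫_ℝ)⁻ ^ 2 + (⟪(v : E3), k⟫_ℝ)⁻ ^ 2) * sin_sq_add_cos_sq δ

lemma neg_cos_le_inner_of_mem_polar (h : IsFrame o u v) (hδ : δ ∈ Ioc 0 (π / 2)) {k m : S2}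
    (hk : k ∈ polar (quarterDisk o u v δ)) (hm : m ∈ polar (quarterDisk o u v δ)) :
    -cos δ ≤ ⟪(k : E3), m⟫_ℝ := by
  have hcross := mul_add_mul_le_of_sq_add_sq_le (cos_nonneg_of_mem_Ioc hδ)
    (h.negPart_sq_add_le_of_mem_polar hδ hk) (h.negPart_sq_add_le_of_mem_polar hδ hm)
  have ho := mul_nonneg (h.inner_nonneg_of_mem_polar hδ hk) (h.inner_nonneg_of_mem_polar hδ hm)
  have hmul (s t : ℝ) : -(s⁺ * t⁻ + s⁻ * t⁺) ≤ s * t := by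
    conv_rhs => rw [← posPart_sub_negPart s, ← posPart_sub_negPart t]
    linear_combination mul_nonneg (posPart_nonneg s) (posPart_nonneg t) +
      mul_nonneg (negPart_nonneg s) (negPart_nonneg t)
  rw [h.inner_eq]
  linear_combination hcross + ho + hmul ⟪(u : E3), k⟫_ℝ ⟪(u : E3), m⟫_ℝ +
    hmul ⟪(v : E3), k⟫_ℝ ⟪(v : E3), m⟫_ℝ

lemma isDiametral_quarterDisk (h : IsFrame o u v) (hδ : δ ∈ Ioc 0 (π / 2)) {d : S2}
    (hd : d ∈ arc u v) :
    IsDiametral (quarterDisk o u v δ) d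
      (greatCirclePoint (h.inner_eq_zero_of_mem_arc hd) (δ - π / 2)) where
  left_mem := mem_polar_quarterDisk hδ hd
  right_mem := greatCirclePoint_mem_polar_quarterDisk hδ _
  inner_le a ha b hb := by
    rw [inner_greatCirclePoint_sub_pi_div_two_self]
    exact h.neg_cos_le_inner_of_mem_polar hδ ha hb

theorem thickness_quarterDisk (h : IsFrame o u v) (hδ : δ ∈ Ioc 0 (π / 2)) :
    thickness (quarterDisk o u v δ) = δ := by
  have hQ := h.isConvexBody_quarterDisk hδ
  obtain ⟨d, hd, -⟩ := h.exists_bisector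
  have hcos := (h.isDiametral_quarterDisk hδ hd).inner_eq hQ
  rw [inner_greatCirclePoint_sub_pi_div_two_self, neg_inj] at hcos
  exact (injOn_cos ⟨hδ.1.le, by linarith [hδ.2, pi_pos]⟩
    (Ioo_subset_Icc_self hQ.thickness_mem_Ioo) hcos).symm

section LargeSubbody

variable {Z : Set S2}

lemma left_mem_of_le_thickness (h : IsFrame o u v) (hδ : δ ∈ Ioc 0 (π / 2))
    (hZ : IsConvexBody Z) (hsub : Z ⊆ quarterDisk o u v δ) (hle : δ ≤ thickness Z) : o ∈ Z := by
  obtain ⟨d, hd, r, hr, hbis⟩ := h.exists_bisector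
  refine hZ.mem_of_le_thickness hδ.1.le hle (k := d) (fun p hp hne => ?_)
    (fun p hp => greatCirclePoint_mem_polar_quarterDisk hδ (h.inner_eq_zero_of_mem_arc hd) p
      (hsub hp)) (inner_greatCirclePoint_sub_pi_div_two_self _)
  obtain ⟨ho, hu, hv⟩ := (mem_quarterDisk_iff hδ).1 (hsub hp)
  refine pos_of_mul_pos_right ?_ hr.le
  rw [← real_inner_smul_left, ← hbis, inner_add_left]
  refine (add_nonneg hu hv).lt_of_ne' fun h0 => ?_
  have hsum := h.sum_inner_sq p
  rw [show ⟪(u : E3), p⟫_ℝ = 0 by linarith, show ⟪(v : E3), p⟫_ℝ = 0 by linarith] at hsum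
  nlinarith [inner_coe_lt_one hne.symm, (cos_nonneg_of_mem_Ioc hδ).trans ho]

lemma mid_mem_and_right_mem_of_pi_div_two_le_thickness (h : IsFrame o u v)
    (hZ : IsConvexBody Z) (hsub : Z ⊆ quarterDisk o u v (π / 2)) (hle : π / 2 ≤ thickness Z) :
    u ∈ Z ∧ v ∈ Z := by
  have hδ : π / 2 ∈ Ioc 0 (π / 2) := ⟨pi_div_two_pos, le_rfl⟩
  rw [← quarterDisk_pi_div_two_rotate] at hsub
  refine ⟨h.rotate.left_mem_of_le_thickness hδ hZ hsub hle, ?_⟩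
  rw [← quarterDisk_pi_div_two_rotate] at hsub
  exact h.rotate.rotate.left_mem_of_le_thickness hδ hZ hsub hle

lemma greatCirclePoint_mem_of_le_thickness (h : IsFrame o u v) (hδ : δ ∈ Ioc 0 (π / 2))
    (hZ : IsConvexBody Z) (hsub : Z ⊆ quarterDisk o u v δ) (hle : δ ≤ thickness Z) {d : S2}
    (hd : d ∈ arc u v) : greatCirclePoint (h.inner_eq_zero_of_mem_arc hd) δ ∈ Z := by
  set w := greatCirclePoint (h.inner_eq_zero_of_mem_arc hd) δ with hw
  rcases hδ.2.eq_or_lt with rfl | hlt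
  · obtain ⟨hu, hv⟩ := h.mid_mem_and_right_mem_of_pi_div_two_le_thickness hZ hsub hle
    have hwd : w = d := by ext1; simp [hw, greatCirclePoint]
    exact hwd ▸ hZ.2.1.2 u hu v hv hd
  · refine hZ.mem_of_le_thickness hδ.1.le hle (m := d)
      (k := greatCirclePoint (h.inner_eq_zero_of_mem_arc hd) (δ - π / 2)) (fun p hp hne => ?_)
      (fun p hp => mem_polar_quarterDisk hδ hd p (hsub hp)) ?_
    · have htangent := cos_mul_one_sub_inner_le (h.inner_eq_zero_of_mem_arc hd)
        ((mem_quarterDisk_iff hδ).1 (hsub hp)).1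
      refine pos_of_mul_pos_right (lt_of_lt_of_le ?_ htangent) (sin_pos_of_mem_Ioc hδ).le
      exact mul_pos (cos_pos_of_mem_Ioo ⟨by linarith [hδ.1, pi_pos], hlt⟩)
        (sub_pos.2 (inner_coe_lt_one hne.symm))
    · rw [real_inner_comm, inner_greatCirclePoint_sub_pi_div_two_self]

end LargeSubbody

lemma exists_mem_arc_greatCirclePoint (h : IsFrame o u v) (hδ : δ ∈ Ioc 0 (π / 2)) {p : S2}
    (hp : p ∈ quarterDisk o u v δ) :
    ∃ d, ∃ hd : d ∈ arc u v, p ∈ arc o (greatCirclePoint (h.inner_eq_zero_of_mem_arc hd) δ) := by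
  obtain ⟨ho, hu, hv⟩ := (mem_quarterDisk_iff hδ).1 hp
  obtain ⟨r, hr, d, hd, hrd, hsq⟩ := h.exists_mem_arc_smul_eq hu hv
  have hsin := sin_pos_of_mem_Ioc hδ
  have hcos := cos_nonneg_of_mem_Ioc hδ
  have hrs : r ≤ sin δ := by
    refine le_of_sq_le_sq ?_ hsin.le
    have hsq' := pow_le_pow_left₀ hcos ho 2
    linear_combination hsq + hsq' + h.sum_inner_sq p - sin_sq_add_cos_sq δ
  refine ⟨d, hd, ⟪(o : E3), p⟫_ℝ - cos δ * (r / sin δ), r / sin δ, ?_, by positivity, ?_⟩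
  · rw [sub_nonneg]
    exact (mul_le_of_le_one_right hcos ((div_le_one hsin).2 hrs)).trans ho
  · conv_lhs => rw [h.eq_add_smul p, hrd]
    rw [greatCirclePoint]
    match_scalars <;> field_simp
    ring

theorem isReduced_quarterDisk (h : IsFrame o u v) (hδ : δ ∈ Ioc 0 (π / 2)) :
    IsReduced (quarterDisk o u v δ) := by
  refine ⟨h.isConvexBody_quarterDisk hδ, fun Z hZ hsub hne => ?_⟩
  rw [h.thickness_quarterDisk hδ]
  by_contra! hle
  refine hne (hsub.antisymm fun p hp => ?_)
  obtain ⟨d, hd, hpd⟩ := h.exists_mem_arc_greatCirclePoint hδ hp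
  exact hZ.2.1.2 o (h.left_mem_of_le_thickness hδ hZ hsub hle) _
    (h.greatCirclePoint_mem_of_le_thickness hδ hZ hsub hle hd) hpd

-- The vector paired with `c` is a positive multiple of the center of the disk circumscribed about
-- the three corners `o`, `cos δ • o + sin δ • u`, `cos δ • o + sin δ • v`.
lemma three_sub_cos_mul_cos_le_norm (h : IsFrame o u v) (hδ : δ ∈ Ioc 0 (π / 2)) {c : S2} {ρ : ℝ}
    (hρ : ρ ∈ Icc 0 π) (hsub : quarterDisk o u v δ ⊆ disk c ρ) :
    (3 - cos δ) * cos ρ ≤ ‖(1 + cos δ) • (o : E3) + sin δ • (u : E3) + sin δ • (v : E3)‖ := by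
  have hmem {p : S2} (hp : p ∈ quarterDisk o u v δ) : cos ρ ≤ ⟪(c : E3), p⟫_ℝ :=
    (mem_disk_iff hρ.1 hρ.2).1 (hsub hp)
  have ho := hmem (h.left_mem_quarterDisk hδ)
  have hu := hmem (h.greatCirclePoint_mem_quarterDisk hδ (d := u) ⟨1, 0, by simp⟩)
  have hv := hmem (h.greatCirclePoint_mem_quarterDisk hδ (d := v) ⟨0, 1, by simp⟩)
  rw [inner_greatCirclePoint_right] at hu hv
  have hCauchy := real_inner_le_norm (c : E3)
    ((1 + cos δ) • (o : E3) + sin δ • (u : E3) + sin δ • (v : E3))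
  rw [norm_eq_of_mem_sphere, one_mul] at hCauchy
  refine le_trans ?_ hCauchy
  simp only [inner_add_right, real_inner_smul_right]
  linear_combination mul_le_mul_of_nonneg_left ho (sub_nonneg.2 (cos_le_one δ)) + hu + hv

theorem arctan_le_of_quarterDisk_subset_disk (h : IsFrame o u v) (hδ : δ ∈ Ioc 0 (π / 2)) {c : S2}
    {ρ : ℝ} (hsub : quarterDisk o u v δ ⊆ disk c ρ) : arctan (√2 * tan (δ / 2)) ≤ ρ := by
  by_contra! hlt
  have hρ0 : 0 ≤ ρ :=
    (InnerProductGeometry.angle_nonneg _ _).trans (hsub (h.left_mem_quarterDisk hδ))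
  have harctan := arctan_lt_pi_div_two (√2 * tan (δ / 2))
  have hcos : cos (arctan (√2 * tan (δ / 2))) < cos ρ :=
    cos_lt_cos_of_nonneg_of_le_pi hρ0 (by linarith [pi_pos]) hlt
  have hnorm := h.three_sub_cos_mul_cos_le_norm hδ ⟨hρ0, by linarith [pi_pos]⟩ hsub
  have hpos : 0 < 3 - cos δ := by linarith [cos_le_one δ]
  have hhalf : cos (δ / 2) ≠ 0 :=
    (cos_pos_of_mem_Ioo ⟨by linarith [hδ.1, pi_pos], by linarith [hδ.2, pi_pos]⟩).ne'
  have hsq : ((3 - cos δ) * cos (arctan (√2 * tan (δ / 2)))) ^ 2 =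
      ‖(1 + cos δ) • (o : E3) + sin δ • (u : E3) + sin δ • (v : E3)‖ ^ 2 := by
    rw [h.norm_smul_add_smul_add_smul_sq, mul_pow, cos_sq_arctan_sqrt_two_mul_tan_half hhalf]
    field_simp
    linear_combination -2 * sin_sq_add_cos_sq δ
  rw [sq_eq_sq₀ (mul_nonneg hpos.le (cos_arctan_pos _).le) (norm_nonneg _)] at hsq
  exact absurd (hnorm.trans_eq hsq.symm) (not_le.2 (mul_lt_mul_of_pos_left hcos hpos))

end IsFrame

end Spherical

theorem mainTheorem1 :
    (∀ R : Set Spherical.S2, Spherical.IsReduced R →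
      Spherical.thickness R ≤ Real.pi / 2 →
      ∃ c : Spherical.S2,
        R ⊆ Spherical.disk c
          (Real.arctan (Real.sqrt 2 * Real.tan (Spherical.thickness R / 2)))) ∧
    (∀ δ : ℝ, 0 < δ → δ ≤ Real.pi / 2 →
      ∀ o u v : Spherical.S2,
        Spherical.sdist o u = Real.pi / 2 → Spherical.sdist o v = Real.pi / 2 →
        Spherical.sdist u v = Real.pi / 2 →
        Spherical.IsReduced (Spherical.quarterDisk o u v δ) ∧
        Spherical.thickness (Spherical.quarterDisk o u v δ) = δ ∧
        ∀ (c : Spherical.S2) (ρ : ℝ),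
          Spherical.quarterDisk o u v δ ⊆ Spherical.disk c ρ →
          Real.arctan (Real.sqrt 2 * Real.tan (δ / 2)) ≤ ρ) := by
  refine ⟨fun R hR hle => hR.exists_subset_disk hle, fun δ h0 h1 o u v hou hov huv => ?_⟩
  have h := Spherical.IsFrame.of_sdist hou hov huv
  exact ⟨h.isReduced_quarterDisk ⟨h0, h1⟩, h.thickness_quarterDisk ⟨h0, h1⟩,
    fun c ρ hsub => h.arctan_le_of_quarterDisk_subset_disk ⟨h0, h1⟩ hsub⟩
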